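/- Let $p\in[2,\infty)$ and $0\le K<\infty$. There is a constant $c<\infty$, depending only on $p$ and $K$, with the following property. Let $m\in\mathbb N$, let $(\Omega,\mathcal F,P)$ be a complete probability space with a filtration $(\mathcal F_t)_{t\ge 0}$, each $\mathcal F_t$ containing all $P$-null sets, and let $Z^1,Z^2,\dots$ be independent $m$-dimensional Lévy processes relative to $(\mathcal F_t)$: each $Z^k$ is $\mathcal F_t$-adapted, starts at $0$ a.s., has stationary increments with $Z^k_t-Z^k_s$ independent of $\mathcal F_s$ for $s\le t$, and a.s. has càdlàg paths. For Borel $A\subset\mathbb R^m\setminus\{0\}$ let $$N_k(t,A)=\#\{0\le s\le t:\ Z^k_s-Z^k_{s-}\in A\},\qquad \nu_k(A)=\mathbb E[N_k(1,A)],$$ and let $N_k(ds,dz)$ be the corresponding random jump measure on $[0,\infty)\times(\mathbb R^m\setminus\{0\})$. Assume that $$\widehat c:=\sup_{k\ge1}\max\left\{\left(\int|z|^2\,\nu_k(dz)\right)^{1/2},\ \left(\int|z|^p\,\nu_k(dz)\right)^{1/p}\right\}\le K .$$ For $1\le j\le m$ let $g^{\cdot,j}=(g^{1,j},g^{2,j},\dots)$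 be an $\ell_2$-valued predictable process, and assume that for each $k$ the process $g^k=(g^{k,1},\dots,g^{k,m})$ is bounded on $\Omega\times[0,\infty)$. Then for every $t\ge0$ $$\mathbb E\left[\left(\sum_{k=1}^\infty\int_0^t\!\int_{\mathbb R^m}|g^k(s)|^2|z|^2\,N_k(ds,dz)\right)^{p/2}\right]\le c\,\mathbb E\left[\left(\int_0^t\sum_{k=1}^\infty|g^k(s)|^2\,ds\right)^{p/2}+\int_0^t\sum_{k=1}^\infty|g^k(s)|^p\,ds\right],$$ where both sides are understood in $[0,\infty]$ and $|\cdot|$ is the Euclidean norm. -/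

import Mathlib

open MeasureTheory ProbabilityTheory Filter Topology
open scoped NNReal ENNReal

noncomputable section

namespace LevyKunita

/-- `m`-dimensional Euclidean space with its Euclidean norm. -/
abbrev Vec (m : ℕ) : Type := EuclideanSpace ℝ (Fin m)

/-- `f` is right continuous with left limits on `[0, ∞)`. -/
def IsCadlag {m : ℕ} (f : ℝ≥0 → Vec m) : Prop :=
  ∀ s : ℝ≥0, ContinuousWithinAt f (Set.Ici s) s ∧ ∃ l : Vec m, Tendsto f (𝓝[<] s) (𝓝 l)

/-- `Z` is an `m`-dimensional Lévy process relative to the filtration `𝓕`. -/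
structure IsLevyProcess {m : ℕ} {Ω : Type*} {mΩ : MeasurableSpace Ω}
    (Z : ℝ≥0 → Ω → Vec m) (𝓕 : Filtration ℝ≥0 mΩ) (P : Measure Ω) : Prop where
  adapted : ∀ t, Measurable[𝓕 t] (Z t)
  zero : ∀ᵐ ω ∂P, Z 0 ω = 0
  indep_increments : ∀ s t, s ≤ t →
    Indep (MeasurableSpace.comap (fun ω => Z t ω - Z s ω) inferInstance) (𝓕 s) P
  stationary : ∀ s h, IdentDistrib (fun ω => Z (s + h) ω - Z s ω) (Z h) P P
  cadlag : ∀ᵐ ω ∂P, IsCadlag (fun t => Z t ω)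

/-- The jump `f s - f (s-)` of a path at time `s`, with the convention `f (0-) = f 0`. -/
def jump {m : ℕ} (f : ℝ≥0 → Vec m) (s : ℝ≥0) : Vec m :=
  f s - Function.leftLim f s

/-- The number of times `s ∈ [0, t]` at which the jump of `f` lies in `A` (for `0 ∉ A`). -/
def jumpCount {m : ℕ} (f : ℝ≥0 → Vec m) (t : ℝ≥0) (A : Set (Vec m)) : ℕ∞ :=
  {s : ℝ≥0 | s ≤ t ∧ jump f s ∈ A}.encard

/-- The jump measure `N(ds, dz)` of the path `f`, the sum of the unit masses at the points
`(s, jump f s)` over the jump times `s` of `f`. -/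
def jumpMeasure {m : ℕ} (f : ℝ≥0 → Vec m) : Measure (ℝ≥0 × Vec m) :=
  Measure.sum fun s : {s : ℝ≥0 // jump f s ≠ 0} => Measure.dirac ((s : ℝ≥0), jump f s)

/-- `N([0, t] × A)` is the number of jumps up to time `t` whose size lies in `A`. -/
theorem jumpMeasure_prod {m : ℕ} (f : ℝ≥0 → Vec m) (t : ℝ≥0) {A : Set (Vec m)}
    (hA : MeasurableSet A) (h0 : (0 : Vec m) ∉ A) :
    jumpMeasure f (Set.Icc 0 t ×ˢ A) = jumpCount f t A := by
  have hm : MeasurableSet (Set.Icc 0 t ×ˢ A) := measurableSet_Icc.prod hA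
  have hz : ∀ s : ℝ≥0, s ∉ {s : ℝ≥0 | jump f s ≠ 0} →
      (Set.Icc 0 t ×ˢ A).indicator (1 : ℝ≥0 × Vec m → ℝ≥0∞) (s, jump f s) = 0 := by
    intro s hs
    have hs0 : jump f s = 0 := by simpa using hs
    simp [hs0, h0]
  have hi : ∀ s : ℝ≥0, (Set.Icc 0 t ×ˢ A).indicator (1 : ℝ≥0 × Vec m → ℝ≥0∞) (s, jump f s)
      = {s : ℝ≥0 | s ≤ t ∧ jump f s ∈ A}.indicator (fun _ => 1) s := by
    intro s
    by_cases h : s ≤ t ∧ jump f s ∈ A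
    · rw [Set.indicator_of_mem (show (s, jump f s) ∈ Set.Icc 0 t ×ˢ A from
        ⟨⟨zero_le, h.1⟩, h.2⟩), Set.indicator_of_mem (by exact h), Pi.one_apply]
    · rw [Set.indicator_of_notMem (fun h' => h ⟨h'.1.2, h'.2⟩), Set.indicator_of_notMem (show s ∉ {s : ℝ≥0 | s ≤ t ∧ jump f s ∈ A} from h)]
  rw [jumpMeasure, Measure.sum_apply _ hm, jumpCount, ← ENNReal.tsum_set_one,
    tsum_subtype {s : ℝ≥0 | s ≤ t ∧ jump f s ∈ A} (fun _ => (1 : ℝ≥0∞))]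
  simp only [Measure.dirac_apply' _ hm]
  refine (tsum_subtype {s : ℝ≥0 | jump f s ≠ 0} (fun s : ℝ≥0 =>
    (Set.Icc 0 t ×ˢ A).indicator (1 : ℝ≥0 × Vec m → ℝ≥0∞) (s, jump f s))).trans ?_
  refine tsum_congr fun s => ?_
  rw [← hi s]
  by_cases h : s ∈ {s : ℝ≥0 | jump f s ≠ 0}
  · rw [Set.indicator_of_mem h]
  · rw [Set.indicator_of_notMem h, hz s h]

/-- The Lévy measure `A ↦ E[N(1, A)]` of the process `Z`: the mean of the random measure
`N([0, 1] × dz)`. -/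
def levyMeasure {m : ℕ} {Ω : Type*} [MeasurableSpace Ω]
    (Z : ℝ≥0 → Ω → Vec m) (P : Measure Ω) : Measure (Vec m) :=
  P.bind fun ω => ((jumpMeasure fun s => Z s ω).restrict (Set.Icc 0 1 ×ˢ Set.univ)).map Prod.snd

/-- If the random measure `N([0, 1] × dz)` is a.e. measurable (as it is for càdlàg processes), then
`levyMeasure Z P A` is the mean number of jumps in `A` up to time `1`. -/
theorem levyMeasure_apply {m : ℕ} {Ω : Type*} [MeasurableSpace Ω]
    (Z : ℝ≥0 → Ω → Vec m) (P : Measure Ω)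
    (hZ : AEMeasurable (fun ω =>
      ((jumpMeasure fun s => Z s ω).restrict (Set.Icc 0 1 ×ˢ Set.univ)).map Prod.snd) P)
    {A : Set (Vec m)} (hA : MeasurableSet A) (h0 : (0 : Vec m) ∉ A) :
    levyMeasure Z P A = ∫⁻ ω, (jumpCount (fun s => Z s ω) 1 A : ℝ≥0∞) ∂P := by
  rw [levyMeasure, Measure.bind_apply hA hZ]
  refine lintegral_congr fun ω => ?_
  rw [Measure.map_apply measurable_snd hA, Measure.restrict_apply (measurable_snd hA),
    ← jumpMeasure_prod _ _ hA h0]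
  congr 1
  ext x
  simp [and_comm]

/-- The moment `(∫ |z|^q ν(dz))^(1/q)`, with values in `[0, ∞]`. -/
def levyMoment {m : ℕ} (ν : Measure (Vec m)) (q : ℝ) : ℝ≥0∞ :=
  (∫⁻ z, ‖z‖ₑ ^ q ∂ν) ^ (1 / q)

/-- `ĉ = sup_k max ((∫ |z|^2 ν_k(dz))^(1/2), (∫ |z|^p ν_k(dz))^(1/p))`, where `ν_k` is the Lévy
measure of `Z k`. -/
def cHat {m : ℕ} {Ω : Type*} [MeasurableSpace Ω]
    (Z : ℕ → ℝ≥0 → Ω → Vec m) (P : Measure Ω) (p : ℝ) : ℝ≥0∞ :=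
  ⨆ k, max (levyMoment (levyMeasure (Z k) P) 2) (levyMoment (levyMeasure (Z k) P) p)

/-- The vector `g^k(s, ω) = (g^{k,1}(s, ω), …, g^{k,m}(s, ω))` of the `k`-th coordinates of the
`ℓ₂`-valued processes `g^{·,1}, …, g^{·,m}`. -/
def coordVec {m : ℕ} {Ω : Type*} (g : Fin m → ℝ≥0 → Ω → lp (fun _ : ℕ => ℝ) 2)
    (k : ℕ) (s : ℝ≥0) (ω : Ω) : Vec m :=
  WithLp.toLp 2 fun j => g j s ω k

end LevyKunita

end

open LevyKunita

/-! Write `q = p / 2` and let `X` be the sum of `|g^k(s)|² |Δ|²` over all jumps `Δ` of all the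
processes up to time `t`. To make everything finite, replace `|z|²` by a continuous cutoff `φ ≤
|z|²` vanishing near the origin, keep finitely many processes, and truncate `X` at a level `N`; all
three are removed at the end by monotone convergence.

A cutoff path sum has finitely many terms. Adding them in order of time, the inequality `(x + d)^q ≤
x^q + 2^q (x^(q-1) d + d^q)` bounds `X^q` by `2^q` times the sum over jump times of `X(s-)^(q-1)
d(s) + d(s)^q`, where `d(s)` is the term added at time `s` (`min_sum_rpow_le`). Independent Lévy
processes have no common jumps (`ae_no_common_jumps`), so only one process contributes to `d(s)`,
and `d(s)^q` splits over `k` into integrals against the jumps weighted by `φ^q`. The integrands are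
predictable, so the compensation formula (`lintegral_weightedJumps_predictable`) replaces each jump
integral, in mean, by a `ds`-integral times the mean of `φ` or `φ^q` under the Lévy measure. These
means are at most `K²` and `K^p`. Bounding `X(s-)` by `X` leaves `E[X^(q-1) ∫ Σ |g^k|² ds]`; Young's
inequality splits it, and half of `E[X^q]` is absorbed on the left, which is legitimate because `X ≤
N` (`lintegral_min_sum_rpow_le`).

The compensation formula is obtained from the definition of a Lévy process alone. The weighted jumps
in an interval are limits of sums of `φ` over increments along fine partitions (`tendsto_incSum`).
Independence and stationarity factor the Laplace transforms of these sums; differentiating at zero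
shows that the mean weighted number of jumps in `(a, a + L]`, on an event known at time `a`, factors
and depends only on `L`. Additivity makes it linear in `L`, and a π-system argument extends the
formula to predictable integrands. -/

namespace LevyKunita

/-! ### Càdlàg paths: jump sums as limits of increment sums -/

section Pathwise

variable {E : Type*} [NormedAddCommGroup E]

/-- Off finitely many times, the increments of a càdlàg path over short intervals are small. -/
theorem exists_finset_dist_lt {f l : ℝ≥0 → E}
    (hr : ∀ s, ContinuousWithinAt f (Set.Ici s) s) (hl : ∀ s, Tendsto f (𝓝[<] s) (𝓝 (l s)))
    (T : ℝ≥0) {η : ℝ} (hη : 0 < η) :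
    ∃ R : Finset ℝ≥0, ∃ δ > 0, ∀ u v, u ≤ v → v ≤ T → dist v u < δ →
      (∀ r ∈ R, ¬(u < r ∧ r ≤ v)) → ‖f v - f u‖ < η := by
  have hU : ∀ s, ∃ U : Set ℝ≥0, IsOpen U ∧ s ∈ U ∧ ∀ x ∈ U,
      (x < s → dist (f x) (l s) < η / 2) ∧ (s ≤ x → dist (f x) (f s) < η / 2) := by
    intro s
    have h1 : ∀ᶠ x in 𝓝 s, s ≤ x → dist (f x) (f s) < η / 2 :=
      eventually_nhdsWithin_iff.1 ((hr s).eventually (Metric.ball_mem_nhds _ (half_pos hη)))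
    have h2 : ∀ᶠ x in 𝓝 s, x < s → dist (f x) (l s) < η / 2 :=
      eventually_nhdsWithin_iff.1 ((hl s).eventually (Metric.ball_mem_nhds _ (half_pos hη)))
    obtain ⟨U, hU, hUo, hsU⟩ := mem_nhds_iff.1 (h2.and h1)
    exact ⟨U, hUo, hsU, fun x hx => hU hx⟩
  choose U hUo hsU hU using hU
  obtain ⟨R, -, hR⟩ := (isCompact_Icc (a := (0 : ℝ≥0)) (b := T)).elim_nhds_subcover U
    fun s _ => (hUo s).mem_nhds (hsU s)
  obtain ⟨δ, hδ, hL⟩ := lebesgue_number_lemma_of_metric (c := fun s : R => U s)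
    (isCompact_Icc (a := (0 : ℝ≥0)) (b := T)) (fun s => hUo s) (by
      intro x hx
      obtain ⟨s, hs, hx⟩ := Set.mem_iUnion₂.1 (hR hx)
      exact Set.mem_iUnion.2 ⟨⟨s, hs⟩, hx⟩)
  refine ⟨R, δ, hδ, fun u v huv hvT hd hn => ?_⟩
  obtain ⟨⟨s, hs⟩, hsub⟩ := hL u ⟨zero_le, huv.trans hvT⟩
  have hu := hU s u (hsub (Metric.mem_ball_self hδ))
  have hv := hU s v (hsub hd)
  rw [← dist_eq_norm]
  rcases lt_or_ge u s with h | h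
  · have hvs : v < s := not_le.1 fun h' => hn s hs ⟨h, h'⟩
    linarith [dist_triangle_right (f v) (f u) (l s), hu.1 h, hv.1 hvs]
  · linarith [dist_triangle_right (f v) (f u) (f s), hu.2 h, hv.2 (h.trans huv)]

/-- The sum of `φ` over the increments of `f` along the uniform partition of `[a, a + L]` into `n`
intervals. -/
noncomputable def incSum (φ : E → ℝ≥0) (f : ℝ≥0 → E) (a L : ℝ≥0) (n : ℕ) : ℝ≥0 :=
  ∑ i ∈ Finset.range n, φ (f (a + (i + 1 : ℕ) * (L / n)) - f (a + i * (L / n)))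

theorem exists_partition_index {a L r : ℝ≥0} {n : ℕ} (hn : 0 < n) (h : a < r) (h' : r ≤ a + L) :
    ∃ i < n, a + i * (L / n) < r ∧ r ≤ a + (i + 1 : ℕ) * (L / n) := by
  classical
  have hn0 : (n : ℝ≥0) ≠ 0 := by positivity
  have hex : ∃ i : ℕ, r ≤ a + i * (L / n) := ⟨n, by rwa [mul_div_cancel₀ _ hn0]⟩
  have h0 : Nat.find hex ≠ 0 := by
    intro h0
    have := Nat.find_spec hex
    rw [h0] at this
    simp at this
    exact absurd h (not_lt.2 this)
  obtain ⟨i, hi⟩ := Nat.exists_eq_succ_of_ne_zero h0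
  refine ⟨i, ?_, ?_, ?_⟩
  · have : Nat.find hex ≤ n := Nat.find_min' hex (by rwa [mul_div_cancel₀ _ hn0])
    omega
  · exact not_le.1 (Nat.find_min hex (by omega))
  · simpa [hi] using Nat.find_spec hex

/-- Small increments are killed by `φ`, so `exists_finset_dist_lt` at level `ε` applies; letting `u`
increase to `s` turns the bound on increments into one on jumps. -/
theorem finite_jumps {φ : E → ℝ≥0} {ε : ℝ} (hε : 0 < ε)
    (hφ0 : ∀ z, ‖z‖ ≤ ε → φ z = 0) {f l : ℝ≥0 → E}
    (hr : ∀ s, ContinuousWithinAt f (Set.Ici s) s) (hl : ∀ s, Tendsto f (𝓝[<] s) (𝓝 (l s)))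
    (T : ℝ≥0) : ∃ R : Finset ℝ≥0, ∃ δ > 0, (∀ u v, u ≤ v → v ≤ T → dist v u < δ →
      (∀ r ∈ R, ¬(u < r ∧ r ≤ v)) → φ (f v - f u) = 0) ∧
      ∀ s ≤ T, 0 < s → s ∉ R → φ (f s - l s) = 0 := by
  obtain ⟨R, δ, hδ, H⟩ := exists_finset_dist_lt hr hl T hε
  refine ⟨R, δ, hδ, fun u v h1 h2 h3 h4 => hφ0 _ (H u v h1 h2 h3 h4).le, fun s hsT hs0 hs => ?_⟩
  apply hφ0
  have : (𝓝[<] s).NeBot := nhdsLT_neBot_of_exists_lt ⟨0, hs0⟩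
  have ht : Tendsto (fun u => ‖f s - f u‖) (𝓝[<] s) (𝓝 ‖f s - l s‖) :=
    (tendsto_const_nhds.sub (hl s)).norm
  refine le_of_tendsto ht ?_
  have h1 : ∀ᶠ u in 𝓝[<] s, dist s u < δ := by
    have : Metric.ball s δ ∈ 𝓝[<] s := nhdsWithin_le_nhds (Metric.ball_mem_nhds _ hδ)
    filter_upwards [this] with u hu
    rwa [dist_comm]
  have h2 : ∀ᶠ u in 𝓝[<] s, ∀ r ∈ R, ¬(u < r ∧ r ≤ s) := by
    rw [Filter.eventually_all_finset]
    intro r hrR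
    rcases lt_or_ge r s with h | h
    · filter_upwards [nhdsWithin_le_nhds (lt_mem_nhds h)] with u hu
      exact fun h' => absurd hu (not_lt.2 h'.1.le)
    · exact Eventually.of_forall fun u h' => hs ((le_antisymm h'.2 h) ▸ hrR)
  filter_upwards [h1, h2, self_mem_nhdsWithin] with u hu1 hu2 hu3
  exact (H u s (le_of_lt hu3) hsT hu1 hu2).le

/-- Only finitely many times `R` in the interval matter. On a fine partition each of them has a cell
of its own and every other cell contributes zero, so the increment sum is a sum over `R`. The
endpoints of the cell of `r` tend to `r`, the left one strictly from below and the right one from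
above or at `r`, so its increment tends to the jump at `r`. -/
theorem tendsto_incSum {φ : E → ℝ≥0} (hφ : Continuous φ) {ε : ℝ} (hε : 0 < ε)
    (hφ0 : ∀ z, ‖z‖ ≤ ε → φ z = 0) {f l : ℝ≥0 → E}
    (hr : ∀ s, ContinuousWithinAt f (Set.Ici s) s) (hl : ∀ s, Tendsto f (𝓝[<] s) (𝓝 (l s)))
    (a L : ℝ≥0) : Tendsto (fun n => (incSum φ f a L n : ℝ≥0∞)) atTop
      (𝓝 (∑' s, (Set.Ioc a (a + L)).indicator (fun s => (φ (f s - l s) : ℝ≥0∞)) s)) := by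
  classical
  obtain ⟨R₀, δ, hδ, H1, H2⟩ := finite_jumps hε hφ0 hr hl (a + L)
  set R := R₀.filter (fun r => a < r ∧ r ≤ a + L) with hR
  have hRm : ∀ r ∈ R, a < r ∧ r ≤ a + L := fun r h => (Finset.mem_filter.1 h).2
  have hsum : ∑' s, (Set.Ioc a (a + L)).indicator (fun s => (φ (f s - l s) : ℝ≥0∞)) s
      = ((∑ r ∈ R, φ (f r - l r) : ℝ≥0) : ℝ≥0∞) := by
    rw [tsum_eq_sum (s := R), ENNReal.ofNNReal_finsetSum]
    · exact Finset.sum_congr rfl fun r h => Set.indicator_of_mem (show r ∈ Set.Ioc a (a + L) from hRm r h) _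
    · intro s hs
      by_cases h : s ∈ Set.Ioc a (a + L)
      · rw [Set.indicator_of_mem h, H2 s h.2 (lt_of_le_of_lt zero_le h.1)
          fun h' => hs (Finset.mem_filter.2 ⟨h', h⟩), ENNReal.coe_zero]
      · exact Set.indicator_of_notMem h _
  rw [hsum, ENNReal.tendsto_coe]
  have hmesh : Tendsto (fun n : ℕ => L / (n : ℝ≥0)) atTop (𝓝 0) :=
    NNReal.tendsto_coe.1 (by simpa using tendsto_const_div_atTop_nhds_zero_nat (L : ℝ))
  have hidx : ∀ n : ℕ, ∀ r : ℝ≥0, ∃ i : ℕ, 0 < n → r ∈ R →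
      i < n ∧ a + i * (L / n) < r ∧ r ≤ a + (i + 1 : ℕ) * (L / n) := by
    intro n r
    by_cases h : 0 < n ∧ r ∈ R
    · obtain ⟨i, hi⟩ := exists_partition_index h.1 (hRm r h.2).1 (hRm r h.2).2
      exact ⟨i, fun _ _ => hi⟩
    · exact ⟨0, fun h1 h2 => absurd ⟨h1, h2⟩ h⟩
  choose idx hidx using hidx
  -- Once the mesh is below the gaps of `R`, no cell contains two points of `R`, so `idx n` is
  -- injective on `R`.
  have hsep : ∀ᶠ n : ℕ in atTop, ∀ r ∈ R, ∀ r' ∈ R, r < r' → r + L / n < r' := by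
    rw [Filter.eventually_all_finset]
    intro r _
    rw [Filter.eventually_all_finset]
    intro r' _
    by_cases h : r < r'
    · have : Tendsto (fun n : ℕ => r + L / (n : ℝ≥0)) atTop (𝓝 (r + 0)) :=
        tendsto_const_nhds.add hmesh
      rw [add_zero] at this
      filter_upwards [this.eventually_lt_const h] with n hn
      exact fun _ => hn
    · exact Eventually.of_forall fun n h' => absurd h' h
  have hδ' : ∀ᶠ n : ℕ in atTop, ((L / (n : ℝ≥0) : ℝ≥0) : ℝ) < δ := by
    have : Tendsto (fun n : ℕ => ((L / (n : ℝ≥0) : ℝ≥0) : ℝ)) atTop (𝓝 ((0 : ℝ≥0) : ℝ)) :=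
      (NNReal.tendsto_coe.2 hmesh)
    exact this.eventually_lt_const (by simpa using hδ)
  have heq : ∀ᶠ n : ℕ in atTop, ∑ r ∈ R, φ (f (a + (idx n r + 1 : ℕ) * (L / n)) -
      f (a + idx n r * (L / n))) = incSum φ f a L n := by
    filter_upwards [hsep, hδ', eventually_gt_atTop 0] with n hs hd hn
    rw [incSum, ← Finset.sum_subset (s₁ := R.image (idx n))]
    · rw [Finset.sum_image]
      intro r hrR r' hrR' hrr
      have h1 := (hidx n r hn hrR).2
      have h2 := (hidx n r' hn hrR').2
      rw [← hrr] at h2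
      push_cast at h1 h2
      by_contra hne
      rcases lt_or_gt_of_ne hne with h | h
      · have h3 := hs r hrR r' hrR' h
        have : a + (idx n r + 1) * (L / n) < r + L / n := by
          rw [add_mul, one_mul, ← add_assoc]; gcongr; exact h1.1
        exact absurd (h2.2.trans_lt (this.trans h3)) (lt_irrefl _)
      · have h3 := hs r' hrR' r hrR h
        have : a + (idx n r + 1) * (L / n) < r' + L / n := by
          rw [add_mul, one_mul, ← add_assoc]; gcongr; exact h2.1
        exact absurd (h1.2.trans_lt (this.trans h3)) (lt_irrefl _)
    · intro i hi
      obtain ⟨r, hrR, rfl⟩ := Finset.mem_image.1 hi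
      exact Finset.mem_range.2 (hidx n r hn hrR).1
    · intro i hi hi'
      have hn0 : (n : ℝ≥0) ≠ 0 := by positivity
      have hin : i + 1 ≤ n := Finset.mem_range.1 hi
      have hle : a + (i + 1 : ℕ) * (L / n) ≤ a + L := by
        have : ((i + 1 : ℕ) : ℝ≥0) * (L / n) ≤ n * (L / n) := by gcongr
        rw [mul_div_cancel₀ _ hn0] at this
        gcongr
      refine H1 _ _ (by gcongr; omega) hle ?_ ?_
      · rw [NNReal.dist_eq]
        push_cast at hd ⊢
        rwa [show (a : ℝ) + (i + 1) * (L / n) - (a + i * (L / n)) = L / n by ring,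
          abs_of_nonneg (by positivity)]
      · rintro r hr0 ⟨h1, h2⟩
        have hrR : r ∈ R := Finset.mem_filter.2 ⟨hr0, lt_of_le_of_lt (by simp) h1, h2.trans hle⟩
        refine hi' (Finset.mem_image.2 ⟨r, hrR, ?_⟩)
        obtain ⟨-, h3, h4⟩ := hidx n r hn hrR
        have key : ∀ j k : ℕ, a + j * (L / n) < a + k * (L / n) → j < k := by
          intro j k h
          by_contra hjk
          exact absurd h (not_lt.2 (by gcongr; omega))
        have := key _ _ (h3.trans_le h2)
        have := key _ _ (h1.trans_le h4)
        omega
  refine Tendsto.congr' heq (tendsto_finsetSum _ fun r hrR => ?_)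
  have hv : Tendsto (fun n : ℕ => a + (idx n r + 1 : ℕ) * (L / n)) atTop (𝓝[≥] r) := by
    refine tendsto_nhdsWithin_of_tendsto_nhds_of_eventually_within _ ?_ ?_
    · refine tendsto_of_tendsto_of_tendsto_of_le_of_le' (g := fun _ => r)
        (h := fun n : ℕ => r + L / n) tendsto_const_nhds
        (by simpa using tendsto_const_nhds.add hmesh) ?_ ?_
      · filter_upwards [eventually_gt_atTop 0] with n hn using (hidx n r hn hrR).2.2
      · filter_upwards [eventually_gt_atTop 0] with n hn
        push_cast
        rw [add_mul, one_mul, ← add_assoc]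
        gcongr
        exact (hidx n r hn hrR).2.1.le
    · filter_upwards [eventually_gt_atTop 0] with n hn using (hidx n r hn hrR).2.2
  have hu : Tendsto (fun n : ℕ => a + idx n r * (L / n)) atTop (𝓝[<] r) := by
    refine tendsto_nhdsWithin_of_tendsto_nhds_of_eventually_within _ ?_ ?_
    · refine tendsto_of_tendsto_of_tendsto_of_le_of_le' (g := fun n : ℕ => r - L / n)
        (h := fun n : ℕ => r) (by
          have : Tendsto (fun n : ℕ => r - L / (n : ℝ≥0)) atTop (𝓝 (r - 0)) :=
            tendsto_const_nhds.sub hmesh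
          simpa using this) tendsto_const_nhds ?_ ?_
      · filter_upwards [eventually_gt_atTop 0] with n hn
        rw [tsub_le_iff_right]
        have := (hidx n r hn hrR).2.2
        push_cast at this
        rwa [add_mul, one_mul, ← add_assoc] at this
      · filter_upwards [eventually_gt_atTop 0] with n hn using (hidx n r hn hrR).2.1.le
    · filter_upwards [eventually_gt_atTop 0] with n hn using (hidx n r hn hrR).2.1
  exact (hφ.tendsto _).comp (((hr r).tendsto.comp hv).sub ((hl r).comp hu))

end Pathwise

/-- A continuous weight function that vanishes in a neighbourhood of the origin. -/
structure IsCutoff {E : Type*} [NormedAddCommGroup E] (φ : E → ℝ≥0) : Prop where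
  continuous : Continuous φ
  eq_zero : ∃ ε : ℝ, 0 < ε ∧ ∀ z, ‖z‖ ≤ ε → φ z = 0

theorem IsCutoff.map_zero {E : Type*} [NormedAddCommGroup E] {φ : E → ℝ≥0} (hφ : IsCutoff φ) :
    φ 0 = 0 := by
  obtain ⟨ε, hε, h⟩ := hφ.eq_zero
  exact h 0 (by simpa using hε.le)

/-! ### The weighted jump measure of one path -/

section Weighted

variable {m : ℕ} {φ : Vec m → ℝ≥0} {f : ℝ≥0 → Vec m}

/-- The measure `∑ₛ φ(Δf(s)) δₛ`. -/
noncomputable def weightedJumps (φ : Vec m → ℝ≥0) (f : ℝ≥0 → Vec m) : Measure ℝ≥0 :=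
  Measure.sum fun s : ℝ≥0 => (φ (jump f s) : ℝ≥0∞) • Measure.dirac s

theorem lintegral_weightedJumps (φ : Vec m → ℝ≥0) (f : ℝ≥0 → Vec m) (h : ℝ≥0 → ℝ≥0∞) :
    ∫⁻ s, h s ∂(weightedJumps φ f) = ∑' s, φ (jump f s) * h s := by
  rw [weightedJumps, lintegral_sum_measure]
  refine tsum_congr fun s => ?_
  rw [lintegral_smul_measure, lintegral_dirac, smul_eq_mul]

theorem setLIntegral_weightedJumps (φ : Vec m → ℝ≥0) (f : ℝ≥0 → Vec m) (h : ℝ≥0 → ℝ≥0∞)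
    {S : Set ℝ≥0} (hS : MeasurableSet S) :
    ∫⁻ s in S, h s ∂(weightedJumps φ f) = ∑' s, S.indicator (fun s => φ (jump f s) * h s) s := by
  rw [← lintegral_indicator hS, lintegral_weightedJumps]
  refine tsum_congr fun s => ?_
  by_cases hs : s ∈ S <;> simp [hs]

theorem weightedJumps_apply (φ : Vec m → ℝ≥0) (f : ℝ≥0 → Vec m) {S : Set ℝ≥0}
    (hS : MeasurableSet S) :
    weightedJumps φ f S = ∑' s, S.indicator (fun s => (φ (jump f s) : ℝ≥0∞)) s := by
  rw [← setLIntegral_one, setLIntegral_weightedJumps _ _ _ hS]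
  simp

theorem jump_zero (f : ℝ≥0 → Vec m) : jump f 0 = 0 := by
  rw [jump, leftLim_eq_of_isBot (a := (0 : ℝ≥0)) fun _ => zero_le, sub_self]

theorem IsCadlag.tendsto_leftLim (hf : IsCadlag f) (s : ℝ≥0) :
    Tendsto f (𝓝[<] s) (𝓝 (Function.leftLim f s)) := by
  obtain ⟨l, hl⟩ := (hf s).2
  exact tendsto_leftLim_of_tendsto ⟨l, hl⟩

theorem tendsto_incSum_weightedJumps (hφ : IsCutoff φ) (hf : IsCadlag f) (a L : ℝ≥0) :
    Tendsto (fun n => (incSum φ f a L n : ℝ≥0∞)) atTop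
      (𝓝 (weightedJumps φ f (Set.Ioc a (a + L)))) := by
  obtain ⟨ε, hε, h⟩ := hφ.eq_zero
  rw [weightedJumps_apply _ _ measurableSet_Ioc]
  exact tendsto_incSum hφ.continuous hε h (fun s => (hf s).1) hf.tendsto_leftLim a L

theorem exists_finset_jump (hφ : IsCutoff φ) (hf : IsCadlag f) (T : ℝ≥0) :
    ∃ R : Finset ℝ≥0, (∀ s ∈ R, s ≤ T) ∧ ∀ s ≤ T, s ∉ R → φ (jump f s) = 0 := by
  classical
  obtain ⟨ε, hε, h⟩ := hφ.eq_zero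
  obtain ⟨R, δ, -, -, hR⟩ := finite_jumps hε h (fun s => (hf s).1) hf.tendsto_leftLim T
  refine ⟨R.filter (· ≤ T), fun s hs => (Finset.mem_filter.1 hs).2, fun s hs hsR => ?_⟩
  rcases eq_or_ne s 0 with rfl | h0
  · rw [jump_zero, hφ.map_zero]
  · exact hR s hs (pos_iff_ne_zero.2 h0) fun h' => hsR (Finset.mem_filter.2 ⟨h', hs⟩)

theorem setLIntegral_weightedJumps_eq_sum {T : ℝ≥0} {R : Finset ℝ≥0}
    (hR : ∀ s ≤ T, s ∉ R → φ (jump f s) = 0) (h : ℝ≥0 → ℝ≥0∞) {S : Set ℝ≥0}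
    (hS : MeasurableSet S) (hST : S ⊆ Set.Iic T) [DecidablePred (· ∈ S)] :
    ∫⁻ s in S, h s ∂(weightedJumps φ f) = ∑ s ∈ R with s ∈ S, φ (jump f s) * h s := by
  rw [setLIntegral_weightedJumps _ _ _ hS, Finset.sum_filter, tsum_eq_sum (s := R)]
  · refine Finset.sum_congr rfl fun s _ => ?_
    by_cases hs : s ∈ S <;> simp [hs]
  · intro s hs
    by_cases h' : s ∈ S
    · rw [Set.indicator_of_mem h', hR s (hST h') hs, ENNReal.coe_zero, zero_mul]
    · exact Set.indicator_of_notMem h' _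

theorem weightedJumps_Iic_lt_top (hφ : IsCutoff φ) (hf : IsCadlag f) (T : ℝ≥0) :
    weightedJumps φ f (Set.Iic T) < ∞ := by
  classical
  obtain ⟨R, -, h2⟩ := exists_finset_jump hφ hf T
  rw [← setLIntegral_one, setLIntegral_weightedJumps_eq_sum h2 _ measurableSet_Iic subset_rfl]
  simp [ENNReal.sum_lt_top]

theorem weightedJumps_singleton_zero (hφ : IsCutoff φ) : weightedJumps φ f {0} = 0 := by
  rw [weightedJumps_apply _ _ (measurableSet_singleton _), ENNReal.tsum_eq_zero]
  intro s
  by_cases h : s = 0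
  · subst h; simp [jump_zero, hφ.map_zero]
  · simp [h]

end Weighted

/-! ### Laplace transforms and stationarity of the mean number of jumps -/

section Increments

variable {m : ℕ} {Ω : Type*} {mΩ : MeasurableSpace Ω} {P : Measure Ω}
  {𝓕 : Filtration ℝ≥0 mΩ} {Z : ℝ≥0 → Ω → Vec m}

theorem measurable_incSum (hZ : ∀ t, Measurable[𝓕 t] (Z t)) {φ : Vec m → ℝ≥0}
    (hφ : Measurable φ) (a L : ℝ≥0) (n : ℕ) :
    Measurable[𝓕 (a + L)] fun ω => incSum φ (fun t => Z t ω) a L n := by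
  unfold incSum
  refine Finset.measurable_sum _ fun i hi => hφ.comp ?_
  have hn : 0 < n := (Nat.zero_le i).trans_lt (Finset.mem_range.1 hi)
  have hn0 : (n : ℝ≥0) ≠ 0 := by positivity
  have hin : i + 1 ≤ n := Finset.mem_range.1 hi
  have hle : ∀ j ≤ n, a + j * (L / n) ≤ a + L := by
    intro j hj
    have : (j : ℝ≥0) * (L / n) ≤ n * (L / n) := by gcongr
    rw [mul_div_cancel₀ _ hn0] at this
    gcongr
  exact ((hZ _).mono (𝓕.mono (hle _ hin)) le_rfl).sub
    ((hZ _).mono (𝓕.mono (hle _ (by omega))) le_rfl)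

theorem measurable_weightedJumps_Ioc (hZ : ∀ t, Measurable[𝓕 t] (Z t))
    (hc : ∀ ω, IsCadlag fun t => Z t ω) {φ : Vec m → ℝ≥0} (hφ : IsCutoff φ) (a L : ℝ≥0) :
    Measurable[𝓕 (a + L)] fun ω => weightedJumps φ (fun t => Z t ω) (Set.Ioc a (a + L)) := by
  refine @measurable_of_tendsto_metrizable _ _ (𝓕 (a + L)) _ _ _ _
    (fun n ω => (incSum φ (fun t => Z t ω) a L n : ℝ≥0∞)) _ (fun n => ?_) ?_
  · exact measurable_coe_nnreal_ennreal.comp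
      (measurable_incSum hZ hφ.continuous.measurable a L n)
  · exact tendsto_pi_nhds.2 fun ω => tendsto_incSum_weightedJumps hφ (hc ω) a L

/-- Induction on `n`: the last increment is independent of the σ-algebra at its left endpoint, which
contains `F` and all earlier factors. -/
theorem lintegral_prod_increments (hZ : IsLevyProcess Z 𝓕 P) {a : ℝ≥0} (h : ℝ≥0) {F : Set Ω}
    (hF : MeasurableSet[𝓕 a] F) {g : Vec m → ℝ≥0∞} (hg : Measurable g) (n : ℕ) :
    ∫⁻ ω, F.indicator 1 ω * ∏ i ∈ Finset.range n,
        g (Z (a + (i + 1 : ℕ) * h) ω - Z (a + i * h) ω) ∂P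
      = P F * (∫⁻ ω, g (Z h ω) ∂P) ^ n := by
  induction n with
  | zero => simp [lintegral_indicator_one (𝓕.le _ _ hF)]
  | succ n ih =>
    simp_rw [Finset.prod_range_succ, ← mul_assoc]
    have hle : a + n * h ≤ a + (n + 1 : ℕ) * h := by gcongr; omega
    have hinc : ∫⁻ ω, g (Z (a + (n + 1 : ℕ) * h) ω - Z (a + n * h) ω) ∂P
        = ∫⁻ ω, g (Z h ω) ∂P := by
      have := ((hZ.stationary (a + n * h) h).comp hg).lintegral_eq
      simp only [Function.comp_def] at this
      rw [← this]
      push_cast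
      simp_rw [add_mul, one_mul, add_assoc]
    have hmeas : Measurable[𝓕 (a + n * h)] fun ω => F.indicator (1 : Ω → ℝ≥0∞) ω *
        ∏ i ∈ Finset.range n, g (Z (a + (i + 1 : ℕ) * h) ω - Z (a + i * h) ω) := by
      refine Measurable.mul ?_ (Finset.measurable_prod _ fun i hi => hg.comp ?_)
      · exact Measurable.indicator measurable_const (𝓕.mono (by simp) _ hF)
      · have hin : i + 1 ≤ n := Finset.mem_range.1 hi
        exact ((hZ.adapted _).mono (𝓕.mono (by gcongr)) le_rfl).sub
          ((hZ.adapted _).mono (𝓕.mono (by gcongr; omega)) le_rfl)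
    erw [lintegral_mul_eq_lintegral_mul_lintegral_of_independent_measurableSpace (𝓕.le _)
      (Measurable.comap_le
        (((hZ.adapted _).mono (𝓕.le _) le_rfl).sub ((hZ.adapted _).mono (𝓕.le _) le_rfl)))
      (hZ.indep_increments _ _ hle).symm hmeas
      (hg.comp (comap_measurable fun ω => Z (a + (n + 1 : ℕ) * h) ω - Z (a + n * h) ω)), ih, hinc, pow_succ, mul_assoc]

/-- The Laplace transform `E exp(-c φ(Z_h))`. -/
noncomputable def laplace (P : Measure Ω) (Z : ℝ≥0 → Ω → Vec m) (φ : Vec m → ℝ≥0) (c : ℝ≥0)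
    (h : ℝ≥0) : ℝ≥0∞ :=
  ∫⁻ ω, ENNReal.ofReal (Real.exp (-(c * φ (Z h ω)))) ∂P

/-- The exponential of an increment sum is a product over cells, so its integral over `F` is exactly
`P F * laplace ^ n`. Increment sums converge to weighted jumps, and the exponentials are bounded by
one. -/
theorem tendsto_laplace [IsProbabilityMeasure P] (hZ : IsLevyProcess Z 𝓕 P)
    (hc : ∀ ω, IsCadlag fun t => Z t ω) {φ : Vec m → ℝ≥0} (hφ : IsCutoff φ) (c : ℝ≥0)
    (a L : ℝ≥0) {F : Set Ω} (hF : MeasurableSet[𝓕 a] F) :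
    Tendsto (fun n : ℕ => P F * laplace P Z φ c (L / n) ^ n) atTop
      (𝓝 (∫⁻ ω in F, ENNReal.ofReal (Real.exp (-(c * (weightedJumps φ (fun t => Z t ω)
        (Set.Ioc a (a + L))).toReal))) ∂P)) := by
  have hexp : Continuous fun x : ℝ => ENNReal.ofReal (Real.exp (-(c * x))) :=
    ENNReal.continuous_ofReal.comp (by fun_prop)
  have hfin : ∀ ω, weightedJumps φ (fun t => Z t ω) (Set.Ioc a (a + L)) ≠ ∞ := fun ω =>
    ((measure_mono Set.Ioc_subset_Iic_self).trans_lt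
      (weightedJumps_Iic_lt_top hφ (hc ω) (a + L))).ne
  have h1 : ∀ n : ℕ, ∫⁻ ω in F, ENNReal.ofReal (Real.exp (-(c * (incSum φ (fun t => Z t ω) a L n :
      ℝ)))) ∂P = P F * laplace P Z φ c (L / n) ^ n := by
    intro n
    have hg : Measurable fun z : Vec m => ENNReal.ofReal (Real.exp (-(c * (φ z : ℝ)))) :=
      (hexp.comp (NNReal.continuous_coe.comp hφ.continuous)).measurable
    rw [laplace, ← lintegral_prod_increments hZ (L / n) hF hg n,
      ← lintegral_indicator (𝓕.le _ _ hF)]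
    refine lintegral_congr fun ω => ?_
    by_cases hω : ω ∈ F
    · rw [Set.indicator_of_mem hω, Set.indicator_of_mem hω, Pi.one_apply, one_mul,
        ← ENNReal.ofReal_prod_of_nonneg fun _ _ => (Real.exp_pos _).le, ← Real.exp_sum, incSum]
      push_cast
      rw [Finset.mul_sum, Finset.sum_neg_distrib]
    · simp [hω]
  simp_rw [← h1]
  refine tendsto_lintegral_of_dominated_convergence 1 (fun n => ?_) (fun n => ?_) ?_ ?_
  · exact hexp.measurable.comp (measurable_coe_nnreal_real.comp
      ((measurable_incSum hZ.adapted hφ.continuous.measurable a L n).mono (𝓕.le _) le_rfl))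
  · refine Eventually.of_forall fun ω => ?_
    simp only [Pi.one_apply]
    exact ENNReal.ofReal_le_one.2 (Real.exp_le_one_iff.2 (by simp; positivity))
  · simp
  · refine Eventually.of_forall fun ω => (hexp.tendsto _).comp ?_
    have := (ENNReal.tendsto_toReal (hfin ω)).comp (tendsto_incSum_weightedJumps hφ (hc ω) a L)
    simpa [Function.comp_def] using this

/-- Apart from the factor `P F`, the approximating sequence in `tendsto_laplace` involves neither
`a` nor `F`; limits are unique. -/
theorem lintegral_laplace_weightedJumps [IsProbabilityMeasure P] (hZ : IsLevyProcess Z 𝓕 P)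
    (hc : ∀ ω, IsCadlag fun t => Z t ω) {φ : Vec m → ℝ≥0} (hφ : IsCutoff φ) (c : ℝ≥0)
    (a L : ℝ≥0) {F : Set Ω} (hF : MeasurableSet[𝓕 a] F) :
    ∫⁻ ω in F, ENNReal.ofReal (Real.exp (-(c * (weightedJumps φ (fun t => Z t ω)
        (Set.Ioc a (a + L))).toReal))) ∂P
      = P F * ∫⁻ ω, ENNReal.ofReal (Real.exp (-(c * (weightedJumps φ (fun t => Z t ω)
        (Set.Ioc 0 L)).toReal))) ∂P := by
  have h1 := tendsto_laplace hZ hc hφ c a L hF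
  have h2 := tendsto_laplace hZ hc hφ c 0 L (F := Set.univ) MeasurableSet.univ
  simp only [measure_univ, one_mul, zero_add, Measure.restrict_univ] at h2
  exact tendsto_nhds_unique h1 (ENNReal.Tendsto.const_mul h2 (Or.inr (measure_ne_top P F)))

theorem tendsto_mul_one_sub_exp (x : ℝ) :
    Tendsto (fun n : ℕ => (n : ℝ) * (1 - Real.exp (-(((n : ℝ≥0)⁻¹ : ℝ≥0) * x)))) atTop (𝓝 x) := by
  have hd : HasDerivAt (fun y : ℝ => 1 - Real.exp (-(y * x))) x 0 := by
    have : HasDerivAt (fun y : ℝ => 1 - Real.exp (-(y * x))) (-(Real.exp (-(0 * x)) * (-(1 * x)))) 0 :=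
      (((hasDerivAt_id (0 : ℝ)).mul_const x).neg.exp).const_sub 1
    simpa using this
  have := hd.tendsto_slope_zero_right.comp
    (tendsto_inv_atTop_nhdsGT_zero.comp (tendsto_natCast_atTop_atTop (R := ℝ)))
  refine this.congr fun n => ?_
  simp

/-- For a finite random variable `Φ`, the quantities `n E[1 - exp(-Φ/n)]` converge to `E Φ`. -/
theorem tendsto_lintegral_one_sub_exp (μ : Measure Ω) {Φ : Ω → ℝ≥0∞} (hΦ : Measurable Φ)
    (hfin : ∀ ω, Φ ω ≠ ∞) :
    Tendsto (fun n : ℕ => ∫⁻ ω, ENNReal.ofReal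
        (n * (1 - Real.exp (-(((n : ℝ≥0)⁻¹ : ℝ≥0) * (Φ ω).toReal)))) ∂μ) atTop
      (𝓝 (∫⁻ ω, Φ ω ∂μ)) := by
  have hm : ∀ n : ℕ, Measurable fun ω => ENNReal.ofReal
      (n * (1 - Real.exp (-(((n : ℝ≥0)⁻¹ : ℝ≥0) * (Φ ω).toReal)))) := fun n => by fun_prop
  have hle : ∀ (n : ℕ) ω, ENNReal.ofReal
      (n * (1 - Real.exp (-(((n : ℝ≥0)⁻¹ : ℝ≥0) * (Φ ω).toReal)))) ≤ Φ ω := by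
    intro n ω
    refine ENNReal.ofReal_le_of_le_toReal ?_
    rcases Nat.eq_zero_or_pos n with rfl | hn
    · simp
    · have hn' : (0 : ℝ) < n := by exact_mod_cast hn
      have := Real.add_one_le_exp (-(((n : ℝ≥0)⁻¹ : ℝ≥0) * (Φ ω).toReal))
      calc (n : ℝ) * (1 - Real.exp (-(((n : ℝ≥0)⁻¹ : ℝ≥0) * (Φ ω).toReal)))
          ≤ n * (((n : ℝ≥0)⁻¹ : ℝ≥0) * (Φ ω).toReal) := by gcongr; linarith
        _ = (Φ ω).toReal := by push_cast; field_simp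
  have hlim : ∀ ω, Tendsto (fun n : ℕ => ENNReal.ofReal
      (n * (1 - Real.exp (-(((n : ℝ≥0)⁻¹ : ℝ≥0) * (Φ ω).toReal))))) atTop (𝓝 (Φ ω)) := by
    intro ω
    have := ENNReal.tendsto_ofReal (tendsto_mul_one_sub_exp (Φ ω).toReal)
    rwa [ENNReal.ofReal_toReal (hfin ω)] at this
  -- Fatou gives the lower bound and `1 - exp(-x) ≤ x` the upper one, so the mean of `Φ` may be
  -- infinite.
  refine tendsto_of_le_liminf_of_limsup_le ?_ ?_
  · calc ∫⁻ ω, Φ ω ∂μ = ∫⁻ ω, liminf (fun n : ℕ => ENNReal.ofReal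
        (n * (1 - Real.exp (-(((n : ℝ≥0)⁻¹ : ℝ≥0) * (Φ ω).toReal))))) atTop ∂μ :=
          lintegral_congr fun ω => (hlim ω).liminf_eq.symm
      _ ≤ _ := lintegral_liminf_le hm
  · exact limsup_le_of_le (h := Eventually.of_forall fun n => lintegral_mono (hle n))

theorem measurable_weightedJumps_Ioc' (hZ : IsLevyProcess Z 𝓕 P)
    (hc : ∀ ω, IsCadlag fun t => Z t ω) {φ : Vec m → ℝ≥0} (hφ : IsCutoff φ) (a L : ℝ≥0) :
    Measurable fun ω => weightedJumps φ (fun t => Z t ω) (Set.Ioc a (a + L)) :=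
  (measurable_weightedJumps_Ioc hZ.adapted hc hφ a L).mono (𝓕.le _) le_rfl

/-- Differentiate the Laplace identity at zero: both sides are limits of `n E[1 - exp(-Φ/n)]`, which
agree for every `n`. No finiteness of the mean is needed. -/
theorem setLIntegral_weightedJumps_Ioc [IsProbabilityMeasure P] (hZ : IsLevyProcess Z 𝓕 P)
    (hc : ∀ ω, IsCadlag fun t => Z t ω) {φ : Vec m → ℝ≥0} (hφ : IsCutoff φ)
    (a L : ℝ≥0) {F : Set Ω} (hF : MeasurableSet[𝓕 a] F) :
    ∫⁻ ω in F, weightedJumps φ (fun t => Z t ω) (Set.Ioc a (a + L)) ∂P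
      = P F * ∫⁻ ω, weightedJumps φ (fun t => Z t ω) (Set.Ioc 0 L) ∂P := by
  have hfin : ∀ a ω, weightedJumps φ (fun t => Z t ω) (Set.Ioc a (a + L)) ≠ ∞ := fun a ω =>
    ((measure_mono Set.Ioc_subset_Iic_self).trans_lt
      (weightedJumps_Iic_lt_top hφ (hc ω) (a + L))).ne
  have hm := fun a => measurable_weightedJumps_Ioc' hZ hc hφ a L
  have h1 := tendsto_lintegral_one_sub_exp (P.restrict F) (hm a) (hfin a)
  have h2 := tendsto_lintegral_one_sub_exp P (hm 0) (hfin 0)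
  rw [zero_add] at h2
  refine tendsto_nhds_unique h1 ((ENNReal.Tendsto.const_mul h2
    (Or.inr (measure_ne_top P F))).congr fun n => ?_)
  have hsub : ∀ (μ : Measure Ω) [IsFiniteMeasure μ] (Φ : Ω → ℝ≥0∞), Measurable Φ →
      ∫⁻ ω, ENNReal.ofReal (n * (1 - Real.exp (-(((n : ℝ≥0)⁻¹ : ℝ≥0) * (Φ ω).toReal)))) ∂μ
      = n * (μ Set.univ - ∫⁻ ω, ENNReal.ofReal
        (Real.exp (-(((n : ℝ≥0)⁻¹ : ℝ≥0) * (Φ ω).toReal))) ∂μ) := by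
    intro μ _ Φ hΦ
    have hle : ∀ ω, ENNReal.ofReal (Real.exp (-(((n : ℝ≥0)⁻¹ : ℝ≥0) * (Φ ω).toReal))) ≤ 1 :=
      fun ω => ENNReal.ofReal_le_one.2 (Real.exp_le_one_iff.2 (by simp; positivity))
    have hne : ∫⁻ ω, ENNReal.ofReal (Real.exp (-(((n : ℝ≥0)⁻¹ : ℝ≥0) * (Φ ω).toReal))) ∂μ ≠ ∞ :=
      ((lintegral_mono hle).trans_lt (by simp)).ne
    rw [← lintegral_one, ← lintegral_sub (by fun_prop) hne (Eventually.of_forall hle),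
      ← lintegral_const_mul _ (by fun_prop)]
    refine lintegral_congr fun ω => ?_
    rw [ENNReal.ofReal_mul (by positivity), ENNReal.ofReal_sub _ (Real.exp_pos _).le,
      ENNReal.ofReal_one, ENNReal.ofReal_natCast]
  have h0 := hm 0
  rw [zero_add] at h0
  rw [hsub _ _ (hm a), hsub _ _ h0, lintegral_laplace_weightedJumps hZ hc hφ _ a L hF,
    measure_univ, Measure.restrict_apply_univ]
  rw [← mul_assoc, mul_comm (P F), mul_assoc, ENNReal.mul_sub, mul_one]
  exact fun _ _ => measure_ne_top P F

end Increments

/-- Additivity with nonnegative values forces monotonicity. Squeezing `n * L` between consecutive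
integers bounds `n` times the error by `M 1` for every `n`. -/
theorem eq_mul_of_additive {M : ℝ≥0 → ℝ≥0∞} (hadd : ∀ x y, M (x + y) = M x + M y)
    (h1 : M 1 ≠ ∞) (L : ℝ≥0) : M L = L * M 1 := by
  have hmono : Monotone M := fun x y h => by
    rw [← add_tsub_cancel_of_le h, hadd]; exact le_self_add
  have hmul : ∀ (n : ℕ) x, M (n * x) = n * M x := by
    intro n x
    induction n with
    | zero =>
      have h0 : M 0 ≠ ∞ := ((hmono zero_le_one).trans_lt h1.lt_top).ne
      have := hadd 0 0
      rw [add_zero] at this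
      have h0' : M 0 = 0 := by
        by_contra hne
        exact absurd this (ENNReal.lt_add_right h0 hne).ne
      simp [h0']
    | succ n ih => push_cast; rw [add_mul, one_mul, hadd, ih, add_mul, one_mul]
  have hnat : ∀ n : ℕ, M n = n * M 1 := fun n => by simpa using hmul n 1
  have hfin : ∀ x, M x ≠ ∞ := fun x => by
    refine ((hmono (Nat.le_ceil x)).trans_lt ?_).ne
    rw [hnat]
    exact ENNReal.mul_lt_top (by simp) h1.lt_top
  have key : ∀ n : ℕ, |(M L).toReal - L * (M 1).toReal| * n ≤ (M 1).toReal := by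
    intro n
    have a1 : M (⌊n * L⌋₊ : ℕ) ≤ M (n * L) := hmono (Nat.floor_le zero_le)
    have a2 : M (n * L) ≤ M ((⌊n * L⌋₊ + 1 : ℕ) : ℝ≥0) := hmono (by
      push_cast; exact (Nat.lt_floor_add_one _).le)
    rw [hmul, hnat] at a1 a2
    have b1 := ENNReal.toReal_mono (ENNReal.mul_ne_top (by simp) (hfin L)) a1
    have b2 := ENNReal.toReal_mono (ENNReal.mul_ne_top (by simp) h1) a2
    simp only [ENNReal.toReal_mul, ENNReal.toReal_natCast] at b1 b2
    have c1 : ((⌊n * L⌋₊ : ℕ) : ℝ) ≤ n * L := by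
      exact_mod_cast Nat.floor_le (zero_le : (0 : ℝ≥0) ≤ n * L)
    have c2 : (n : ℝ) * L ≤ (⌊n * L⌋₊ : ℕ) + 1 := by
      exact_mod_cast (Nat.lt_floor_add_one ((n : ℝ≥0) * L)).le
    push_cast at b2
    have hM : 0 ≤ (M 1).toReal := ENNReal.toReal_nonneg
    have d1 := mul_le_mul_of_nonneg_right c1 hM
    have d2 := mul_le_mul_of_nonneg_right c2 hM
    have hn : (0 : ℝ) ≤ n := n.cast_nonneg
    rw [show ∀ x : ℝ, |x| * n = |x * n| from fun x => by rw [abs_mul, abs_of_nonneg hn], abs_le]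
    constructor <;> nlinarith
  have hz : (M L).toReal = L * (M 1).toReal := by
    by_contra hne
    have hpos : 0 < |(M L).toReal - L * (M 1).toReal| := abs_pos.2 (sub_ne_zero.2 hne)
    obtain ⟨n, hn⟩ := exists_nat_gt ((M 1).toReal / |(M L).toReal - L * (M 1).toReal|)
    rw [div_lt_iff₀ hpos] at hn
    linarith [key n]
  rw [← ENNReal.ofReal_toReal (hfin L), hz, ENNReal.ofReal_mul (by positivity),
    ENNReal.ofReal_toReal h1, ENNReal.ofReal_coe_nnreal]

/-! ### Measurability of integrals against pointwise finite kernels -/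

section Kernel

variable {α β : Type*} {mα : MeasurableSpace α} {mβ : MeasurableSpace β}

/-- The masses need not be uniformly bounded, so the parameter space is cut according to the integer
part of the mass; each piece is a finite kernel. -/
theorem isSFiniteKernel_of_isFiniteMeasure (κ : Kernel α β) (hκ : ∀ a, IsFiniteMeasure (κ a)) :
    IsSFiniteKernel κ := by
  classical
  have hm : ∀ n : ℕ, MeasurableSet {a | ⌊(κ a Set.univ).toNNReal⌋₊ = n} := fun n =>
    (Nat.measurable_floor.comp (κ.measurable_coe MeasurableSet.univ).ennreal_toNNReal)
      (measurableSet_singleton n)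
  have hf : ∀ n, IsFiniteKernel (Kernel.piecewise (hm n) κ 0) := fun n => by
    refine ⟨(n + 1 : ℕ), by simp, fun a => ?_⟩
    rw [Kernel.piecewise_apply]
    split_ifs with h
    · have h' : ⌊(κ a Set.univ).toNNReal⌋₊ = n := h
      rw [← ENNReal.coe_toNNReal (measure_ne_top (κ a) Set.univ)]
      have := (Nat.lt_floor_add_one (κ a Set.univ).toNNReal).le
      rw [h'] at this
      exact_mod_cast this
    · simp
  refine ⟨⟨_, hf, ?_⟩⟩
  ext a s hs
  rw [Kernel.sum_apply' _ _ hs, tsum_eq_single ⌊(κ a Set.univ).toNNReal⌋₊]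
  · rw [Kernel.piecewise_apply, if_pos (by rfl)]
  · intro n hn
    rw [Kernel.piecewise_apply, if_neg (show a ∉ {a | ⌊(κ a Set.univ).toNNReal⌋₊ = n} from
      fun h => hn (Eq.symm h))]
    simp

theorem measurable_lintegral_of_isFiniteMeasure {κ : α → Measure β} (hκ : Measurable κ)
    (hf : ∀ a, IsFiniteMeasure (κ a)) {f : α → β → ℝ≥0∞} (hfm : Measurable (Function.uncurry f)) :
    Measurable fun a => ∫⁻ b, f a b ∂(κ a) := by
  have : IsSFiniteKernel (⟨κ, hκ⟩ : Kernel α β) := isSFiniteKernel_of_isFiniteMeasure _ hf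
  exact Measurable.lintegral_kernel_prod_right (κ := ⟨κ, hκ⟩) hfm

end Kernel

/-! ### The compensation formula -/

section Compensation

variable {m : ℕ} {Ω : Type*} {mΩ : MeasurableSpace Ω} {P : Measure Ω}
  {𝓕 : Filtration ℝ≥0 mΩ} {Z : ℝ≥0 → Ω → Vec m}

/-- Lebesgue measure on `[0, ∞)`. -/
noncomputable def leb : Measure ℝ≥0 := (volume.restrict (Set.Ici (0 : ℝ))).map Real.toNNReal

theorem leb_Ioc (a b : ℝ≥0) : leb (Set.Ioc a b) = ENNReal.ofReal (b - a) := by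
  rw [leb, Measure.map_apply measurable_real_toNNReal measurableSet_Ioc,
    Measure.restrict_apply (measurable_real_toNNReal measurableSet_Ioc), ← Real.volume_Ioc]
  congr 1
  ext x
  simp only [Set.mem_inter_iff, Set.mem_preimage, Set.mem_Ioc, Set.mem_Ici]
  constructor
  · rintro ⟨⟨h1, h2⟩, h3⟩
    rw [← NNReal.coe_lt_coe, Real.coe_toNNReal x h3] at h1
    rw [← NNReal.coe_le_coe, Real.coe_toNNReal x h3] at h2
    exact ⟨h1, h2⟩
  · rintro ⟨h1, h2⟩
    have h3 : 0 ≤ x := a.2.trans h1.le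
    refine ⟨⟨?_, ?_⟩, h3⟩
    · rwa [← NNReal.coe_lt_coe, Real.coe_toNNReal x h3]
    · rwa [← NNReal.coe_le_coe, Real.coe_toNNReal x h3]

theorem leb_singleton_zero : leb {0} = 0 := by
  rw [leb, Measure.map_apply measurable_real_toNNReal (measurableSet_singleton _),
    Measure.restrict_apply (measurable_real_toNNReal (measurableSet_singleton _))]
  refine measure_mono_null (t := {0}) ?_ Real.volume_singleton
  rintro x ⟨h1, h2⟩
  simp only [Set.mem_preimage, Set.mem_singleton_iff, Real.toNNReal_eq_zero] at h1
  exact le_antisymm h1 h2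

theorem measure_Iic_eq_Ioc {μ : Measure ℝ≥0} (h : μ {0} = 0) (T : ℝ≥0) :
    μ (Set.Iic T) = μ (Set.Ioc 0 T) := by
  have : Set.Iic T = {0} ∪ Set.Ioc 0 T := by
    ext x
    rcases eq_or_ne x 0 with rfl | hx
    · simp
    · simp
  refine le_antisymm ?_ (measure_mono Set.Ioc_subset_Iic_self)
  rw [this]
  exact (measure_union_le _ _).trans (by rw [h, zero_add])

theorem leb_Iic (T : ℝ≥0) : leb (Set.Iic T) = T := by
  rw [measure_Iic_eq_Ioc leb_singleton_zero, leb_Ioc]; simp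

theorem isFiniteMeasure_weightedJumps_restrict {φ : Vec m → ℝ≥0} (hφ : IsCutoff φ)
    {f : ℝ≥0 → Vec m} (hf : IsCadlag f) (T : ℝ≥0) :
    IsFiniteMeasure ((weightedJumps φ f).restrict (Set.Iic T)) :=
  ⟨by rw [Measure.restrict_apply_univ]; exact weightedJumps_Iic_lt_top hφ hf T⟩

theorem measurable_weightedJumps_Iic (hZ : ∀ t, Measurable[𝓕 t] (Z t))
    (hc : ∀ ω, IsCadlag fun t => Z t ω) {φ : Vec m → ℝ≥0} (hφ : IsCutoff φ) (T : ℝ≥0) :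
    Measurable[𝓕 T] fun ω => weightedJumps φ (fun t => Z t ω) (Set.Iic T) := by
  have := measurable_weightedJumps_Ioc hZ hc hφ 0 T
  rw [zero_add] at this
  simp_rw [measure_Iic_eq_Ioc (weightedJumps_singleton_zero hφ)]
  exact this

theorem measurable_weightedJumps_restrict (hZ : ∀ t, Measurable[𝓕 t] (Z t))
    (hc : ∀ ω, IsCadlag fun t => Z t ω) {φ : Vec m → ℝ≥0} (hφ : IsCutoff φ) (T : ℝ≥0) :
    Measurable[𝓕 T] fun ω => (weightedJumps φ (fun t => Z t ω)).restrict (Set.Iic T) := by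
  have := fun ω => isFiniteMeasure_weightedJumps_restrict hφ (hc ω) T
  refine @Measurable.measure_of_isPiSystem _ _ (𝓕 T) _ _ _ (Set.range Set.Iic)
    ((BorelSpace.measurable_eq (α := ℝ≥0)).trans (borel_eq_generateFrom_Iic ℝ≥0)) isPiSystem_Iic ?_ ?_
  · rintro _ ⟨u, rfl⟩
    simp_rw [Measure.restrict_apply (measurableSet_Iic (a := u)), Set.Iic_inter_Iic]
    exact (measurable_weightedJumps_Iic hZ hc hφ _).mono (𝓕.mono inf_le_right) le_rfl
  · simp_rw [Measure.restrict_apply_univ]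
    exact measurable_weightedJumps_Iic hZ hc hφ T

/-- The mean of the weighted number of jumps up to time `L`. -/
noncomputable def meanJumps (P : Measure Ω) (Z : ℝ≥0 → Ω → Vec m) (φ : Vec m → ℝ≥0) (L : ℝ≥0) :
    ℝ≥0∞ :=
  ∫⁻ ω, weightedJumps φ (fun t => Z t ω) (Set.Ioc 0 L) ∂P

theorem meanJumps_eq [IsProbabilityMeasure P] (hZ : IsLevyProcess Z 𝓕 P)
    (hc : ∀ ω, IsCadlag fun t => Z t ω) {φ : Vec m → ℝ≥0} (hφ : IsCutoff φ)
    (h1 : meanJumps P Z φ 1 ≠ ∞) (L : ℝ≥0) : meanJumps P Z φ L = L * meanJumps P Z φ 1 := by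
  refine eq_mul_of_additive (fun x y => ?_) h1 L
  have hy := setLIntegral_weightedJumps_Ioc hZ hc hφ x y (F := Set.univ) MeasurableSet.univ
  rw [measure_univ, one_mul, Measure.restrict_univ] at hy
  rw [meanJumps, meanJumps, meanJumps, ← hy, ← lintegral_add_right _
    (measurable_weightedJumps_Ioc' hZ hc hφ x y)]
  refine lintegral_congr fun ω => ?_
  rw [← measure_union _ measurableSet_Ioc, Set.Ioc_union_Ioc_eq_Ioc zero_le (by simp)]
  exact Set.Ioc_disjoint_Ioc_of_le le_rfl

theorem predictable_le : 𝓕.predictable ≤ (inferInstance : MeasurableSpace (ℝ≥0 × Ω)) :=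
  measurableSpace_le_predictable_of_measurableSet
    (fun _ hA => (measurableSet_singleton _).prod (𝓕.le _ _ hA))
    (fun _ _ hA => measurableSet_Ioi.prod (𝓕.le _ _ hA))

/-- Rectangles over `{0}` and over `(i, ∞)` are disjoint, so only intersections of the same type
occur; over rays the later starting time is used. -/
theorem isPiSystem_predictable : IsPiSystem
    ({s : Set (ℝ≥0 × Ω) | ∃ A, MeasurableSet[𝓕 ⊥] A ∧ s = {⊥} ×ˢ A} ∪
      {s | ∃ i A, MeasurableSet[𝓕 i] A ∧ s = Set.Ioi i ×ˢ A}) := by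
  rintro s (⟨A, hA, rfl⟩ | ⟨i, A, hA, rfl⟩) t (⟨B, hB, rfl⟩ | ⟨j, B, hB, rfl⟩) hne
  · exact Or.inl ⟨A ∩ B, hA.inter hB, by rw [Set.prod_inter_prod, Set.inter_self]⟩
  · obtain ⟨x, ⟨h1, -⟩, ⟨h2, -⟩⟩ := hne
    rw [Set.mem_singleton_iff.1 h1] at h2
    exact absurd (Set.mem_Ioi.1 h2) not_lt_bot
  · obtain ⟨x, ⟨h2, -⟩, ⟨h1, -⟩⟩ := hne
    rw [Set.mem_singleton_iff.1 h1] at h2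
    exact absurd (Set.mem_Ioi.1 h2) not_lt_bot
  · refine Or.inr ⟨i ⊔ j, A ∩ B, (𝓕.mono le_sup_left _ hA).inter (𝓕.mono le_sup_right _ hB), ?_⟩
    rw [Set.prod_inter_prod, Set.Ioi_inter_Ioi]

/-- The compensation formula for predictable integrands. -/
theorem lintegral_weightedJumps_predictable [IsProbabilityMeasure P] (hZ : IsLevyProcess Z 𝓕 P)
    (hc : ∀ ω, IsCadlag fun t => Z t ω) {φ : Vec m → ℝ≥0} (hφ : IsCutoff φ)
    (h1 : meanJumps P Z φ 1 ≠ ∞) (T : ℝ≥0) {H : ℝ≥0 × Ω → ℝ≥0∞}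
    (hH : Measurable[𝓕.predictable] H) :
    ∫⁻ ω, ∫⁻ s in Set.Iic T, H (s, ω) ∂(weightedJumps φ fun t => Z t ω) ∂P
      = meanJumps P Z φ 1 * ∫⁻ ω, ∫⁻ s in Set.Iic T, H (s, ω) ∂leb ∂P := by
  have hκm : Measurable fun ω => (weightedJumps φ (fun t => Z t ω)).restrict (Set.Iic T) :=
    (measurable_weightedJumps_restrict hZ.adapted hc hφ T).mono (𝓕.le _) le_rfl
  set κ : Kernel Ω ℝ≥0 := ⟨_, hκm⟩ with hκ
  have hκa : ∀ ω, κ ω = (weightedJumps φ (fun t => Z t ω)).restrict (Set.Iic T) := fun _ => rfl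
  have hsf : IsSFiniteKernel κ := isSFiniteKernel_of_isFiniteMeasure κ
    fun ω => isFiniteMeasure_weightedJumps_restrict hφ (hc ω) T
  have hleb : IsFiniteMeasure (leb.restrict (Set.Iic T)) :=
    ⟨by rw [Measure.restrict_apply_univ, leb_Iic]; simp⟩
  have hHm : Measurable H := hH.mono predictable_le le_rfl
  have hsw : Measurable (Prod.swap : Ω × ℝ≥0 → ℝ≥0 × Ω) := measurable_swap
  set M₁ : Measure (ℝ≥0 × Ω) := (P ⊗ₘ κ).map Prod.swap with hM₁
  -- `M₁` integrates against the jumps and `M₂` against the compensator, both up to time `T`. The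
  -- formula says that they agree on the predictable σ-algebra.
  set M₂ : Measure (ℝ≥0 × Ω) := meanJumps P Z φ 1 • (P.prod (leb.restrict (Set.Iic T))).map Prod.swap
    with hM₂
  have hI₁ : ∫⁻ x, H x ∂M₁
      = ∫⁻ ω, ∫⁻ s in Set.Iic T, H (s, ω) ∂(weightedJumps φ fun t => Z t ω) ∂P := by
    rw [hM₁, lintegral_map hHm hsw, Measure.lintegral_compProd (f := fun x => H x.swap)
      (hHm.comp hsw)]
    rfl
  have hI₂ : ∫⁻ x, H x ∂M₂
      = meanJumps P Z φ 1 * ∫⁻ ω, ∫⁻ s in Set.Iic T, H (s, ω) ∂leb ∂P := by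
    rw [hM₂, lintegral_smul_measure, lintegral_map hHm hsw,
      lintegral_prod (fun x => H x.swap) (hHm.comp hsw).aemeasurable]
    rfl
  have hr₁ : ∀ (B : Set ℝ≥0) (A : Set Ω), MeasurableSet B → MeasurableSet A →
      M₁ (B ×ˢ A) = ∫⁻ ω in A, weightedJumps φ (fun t => Z t ω) (B ∩ Set.Iic T) ∂P := by
    intro B A hB hA
    rw [hM₁, Measure.map_apply hsw (hB.prod hA), Set.preimage_swap_prod,
      Measure.compProd_apply_prod hA hB]
    simp_rw [hκa, Measure.restrict_apply hB]
  have hr₂ : ∀ (B : Set ℝ≥0) (A : Set Ω), MeasurableSet B → MeasurableSet A →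
      M₂ (B ×ˢ A) = meanJumps P Z φ 1 * (P A * leb (B ∩ Set.Iic T)) := by
    intro B A hB hA
    rw [hM₂, Measure.smul_apply, Measure.map_apply hsw (hB.prod hA), Set.preimage_swap_prod,
      Measure.prod_prod, Measure.restrict_apply hB, smul_eq_mul]
  have hIoi : ∀ i A, MeasurableSet[𝓕 i] A → M₁ (Set.Ioi i ×ˢ A) = M₂ (Set.Ioi i ×ˢ A) := by
    intro i A hA
    rw [hr₁ _ _ measurableSet_Ioi (𝓕.le _ _ hA), hr₂ _ _ measurableSet_Ioi (𝓕.le _ _ hA),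
      Set.Ioi_inter_Iic]
    rcases le_total i T with h | h
    · have := setLIntegral_weightedJumps_Ioc hZ hc hφ i (T - i) hA
      rw [add_tsub_cancel_of_le h] at this
      rw [this, leb_Ioc, ← NNReal.coe_sub h, ENNReal.ofReal_coe_nnreal]
      change P A * meanJumps P Z φ (T - i) = _
      rw [meanJumps_eq hZ hc hφ h1]
      ring
    · simp [Set.Ioc_eq_empty_of_le h]
  have hbot : ∀ A, MeasurableSet[𝓕 ⊥] A → M₁ ({⊥} ×ˢ A) = M₂ ({⊥} ×ˢ A) := by
    intro A hA
    have h0 : ∀ μ : Measure ℝ≥0, μ {0} = 0 → μ ({⊥} ∩ Set.Iic T) = 0 := fun μ h =>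
      measure_mono_null Set.inter_subset_left h
    rw [hr₁ _ _ (measurableSet_singleton _) (𝓕.le _ _ hA),
      hr₂ _ _ (measurableSet_singleton _) (𝓕.le _ _ hA), h0 _ leb_singleton_zero]
    simp_rw [h0 _ (weightedJumps_singleton_zero hφ)]
    simp
  -- The whole space is not a generator but the disjoint union of two of them.
  have huniv : M₁ Set.univ = M₂ Set.univ := by
    have hu : (Set.univ : Set (ℝ≥0 × Ω)) = {⊥} ×ˢ Set.univ ∪ Set.Ioi ⊥ ×ˢ Set.univ := by
      rw [← Set.union_prod]
      ext x
      simp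
    have hd : Disjoint (({⊥} : Set ℝ≥0) ×ˢ (Set.univ : Set Ω)) (Set.Ioi ⊥ ×ˢ Set.univ) :=
      Set.disjoint_left.2 fun x h h' => absurd h'.1 (by rw [Set.mem_singleton_iff.1 h.1]; simp)
    rw [hu, measure_union hd (measurableSet_Ioi.prod MeasurableSet.univ),
      measure_union hd (measurableSet_Ioi.prod MeasurableSet.univ),
      hbot _ MeasurableSet.univ, hIoi _ _ MeasurableSet.univ]
  have hfin : IsFiniteMeasure M₂ := by
    constructor
    rw [← Set.univ_prod_univ, hr₂ _ _ MeasurableSet.univ MeasurableSet.univ, Set.univ_inter,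
      leb_Iic]
    exact ENNReal.mul_lt_top h1.lt_top (by simp)
  have hfin₁ : IsFiniteMeasure M₁ := ⟨by rw [huniv]; exact measure_lt_top M₂ _⟩
  -- Equality is claimed only after trimming: rectangles whose event is not known at the left
  -- endpoint are not covered.
  have heq : M₁.trim predictable_le = M₂.trim (predictable_le (𝓕 := 𝓕)) := by
    have : IsFiniteMeasure (M₁.trim (predictable_le (𝓕 := 𝓕))) := isFiniteMeasure_trim _
    refine @ext_of_generate_finite _ 𝓕.predictable _ _ _ rfl isPiSystem_predictable this ?_ ?_
    · intro s hs
      rw [trim_measurableSet_eq _ (MeasurableSpace.measurableSet_generateFrom hs),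
        trim_measurableSet_eq _ (MeasurableSpace.measurableSet_generateFrom hs)]
      rcases hs with ⟨A, hA, rfl⟩ | ⟨i, A, hA, rfl⟩
      · exact hbot A hA
      · exact hIoi i A hA
    · rw [trim_measurableSet_eq _ MeasurableSet.univ, trim_measurableSet_eq _ MeasurableSet.univ,
        huniv]
  rw [← hI₁, ← hI₂, ← lintegral_trim predictable_le hH, heq, lintegral_trim predictable_le hH]

end Compensation

theorem IsCutoff.measurable_coe {m : ℕ} {φ : Vec m → ℝ≥0} (hφ : IsCutoff φ) :
    Measurable fun z => (φ z : ℝ≥0∞) :=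
  measurable_coe_nnreal_ennreal.comp hφ.continuous.measurable

/-! ### Means of jump sums as integrals against the Lévy measure -/

section JumpLaw

variable {m : ℕ} {Ω : Type*} {mΩ : MeasurableSpace Ω} {P : Measure Ω}
  {𝓕 : Filtration ℝ≥0 mΩ} {Z : ℝ≥0 → Ω → Vec m}

theorem setLIntegral_jumpMeasure (f : ℝ≥0 → Vec m) {S : Set ℝ≥0} (hS : MeasurableSet S)
    {F : ℝ≥0 × Vec m → ℝ≥0∞} (hF : ∀ s, F (s, 0) = 0) :
    ∫⁻ x in S ×ˢ Set.univ, F x ∂(jumpMeasure f)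
      = ∑' s, S.indicator (fun s => F (s, jump f s)) s := by
  rw [← lintegral_indicator (hS.prod MeasurableSet.univ), jumpMeasure, lintegral_sum_measure]
  simp only [lintegral_dirac]
  have : ∀ s, (S ×ˢ (Set.univ : Set (Vec m))).indicator F (s, jump f s)
      = S.indicator (fun s => F (s, jump f s)) s := fun s => by
    by_cases hs : s ∈ S <;> simp [hs]
  simp_rw [this]
  refine (tsum_subtype {s : ℝ≥0 | jump f s ≠ 0} (fun s : ℝ≥0 =>
    S.indicator (fun s => F (s, jump f s)) s)).trans (tsum_congr fun s => ?_)
  by_cases h : s ∈ {s : ℝ≥0 | jump f s ≠ 0}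
  · rw [Set.indicator_of_mem h]
  · have h0 : jump f s = 0 := by simpa using h
    rw [Set.indicator_of_notMem h]
    by_cases hs : s ∈ S <;> simp [hs, h0, hF]

/-- The law of the jumps of a path up to time one, `N([0, 1] × dz)`. -/
noncomputable def jumpLaw (f : ℝ≥0 → Vec m) : Measure (Vec m) :=
  ((jumpMeasure f).restrict (Set.Icc 0 1 ×ˢ Set.univ)).map Prod.snd

theorem lintegral_jumpLaw (f : ℝ≥0 → Vec m) {F : Vec m → ℝ≥0∞} (hF : Measurable F)
    (h0 : F 0 = 0) :
    ∫⁻ z, F z ∂(jumpLaw f) = ∑' s, (Set.Iic 1).indicator (fun s => F (jump f s)) s := by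
  rw [jumpLaw, lintegral_map hF measurable_snd, setLIntegral_jumpMeasure f measurableSet_Icc
    (F := fun x => F x.2) fun _ => h0]
  rw [show Set.Icc (0 : ℝ≥0) 1 = Set.Iic 1 from Set.Icc_bot]

theorem lintegral_jumpLaw_cutoff (f : ℝ≥0 → Vec m) {φ : Vec m → ℝ≥0} (hφ : IsCutoff φ) :
    ∫⁻ z, φ z ∂(jumpLaw f) = weightedJumps φ f (Set.Iic 1) := by
  rw [lintegral_jumpLaw f hφ.measurable_coe
    (by simp [hφ.map_zero]), weightedJumps_apply _ _ measurableSet_Iic]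

theorem jumpLaw_singleton_zero (f : ℝ≥0 → Vec m) : jumpLaw f {0} = 0 := by
  rw [jumpLaw, Measure.map_apply measurable_snd (measurableSet_singleton _)]
  refine nonpos_iff_eq_zero.1 ((Measure.restrict_apply_le _ _).trans ?_)
  rw [jumpMeasure, Measure.sum_apply _ (measurable_snd (measurableSet_singleton _))]
  simp only [nonpos_iff_eq_zero, ENNReal.tsum_eq_zero]
  intro s
  rw [Measure.dirac_apply' _ (measurable_snd (measurableSet_singleton _))]
  exact Set.indicator_of_notMem
    (show ((s : ℝ≥0), jump f s) ∉ Prod.snd ⁻¹' {(0 : Vec m)} from fun h => s.2 h) _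

/-- Take `min 1 (n * dist(z, Uᶜ))`, which vanishes off `U` and hence near the origin. -/
theorem exists_cutoff_iSup {U : Set (Vec m)} (hU : IsOpen U) {ε : ℝ} (hε : 0 < ε)
    (h : ∀ z ∈ U, ε < ‖z‖) : ∃ φ : ℕ → Vec m → ℝ≥0, (∀ n, IsCutoff (φ n)) ∧ Monotone φ ∧
      (∀ n z, φ n z ≤ 1) ∧ ∀ z, ⨆ n, (φ n z : ℝ≥0∞) = U.indicator 1 z := by
  have hne : Uᶜ.Nonempty := ⟨0, fun h0 => by simpa using (h 0 h0).trans' hε⟩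
  have h0 : ∀ z ∉ U, Metric.infNndist z Uᶜ = 0 := fun z hz => by
    rw [← NNReal.coe_inj, Metric.coe_infNndist, Metric.infDist_zero_of_mem hz, NNReal.coe_zero]
  refine ⟨fun n z => min 1 (n * Metric.infNndist z Uᶜ), fun n => ⟨?_, ε, hε, fun z hz => ?_⟩,
    fun n k hnk z => ?_, fun n z => min_le_left _ _, fun z => ?_⟩
  · exact continuous_const.min (continuous_const.mul (Metric.continuous_infNndist_pt _))
  · simp [h0 z fun hzU => absurd (h z hzU) (not_lt.2 hz)]
  · show min 1 _ ≤ min 1 _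
    gcongr
  · by_cases hz : z ∈ U
    · rw [Set.indicator_of_mem hz, Pi.one_apply]
      have hpos : 0 < Metric.infNndist z Uᶜ := by
        rw [← NNReal.coe_pos, Metric.coe_infNndist]
        exact (hU.isClosed_compl.notMem_iff_infDist_pos hne).1 (by simpa using hz)
      obtain ⟨n, hn⟩ := exists_nat_gt (Metric.infNndist z Uᶜ)⁻¹
      refine le_antisymm (iSup_le fun k => by exact_mod_cast min_le_left _ _)
        (le_iSup_of_le n ?_)
      show (1 : ℝ≥0∞) ≤ ((min 1 (n * Metric.infNndist z Uᶜ) : ℝ≥0) : ℝ≥0∞)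
      rw [min_eq_left, ENNReal.coe_one]
      rw [← inv_mul_cancel₀ hpos.ne']
      gcongr
    · simp [h0 z hz, hz]

theorem jumpLaw_lt_top {f : ℝ≥0 → Vec m} (hf : IsCadlag f) {ε : ℝ} (hε : 0 < ε) :
    jumpLaw f {z | ε < ‖z‖} < ∞ := by
  have hm : MeasurableSet {z : Vec m | ε < ‖z‖} := measurableSet_lt measurable_const measurable_norm
  have hφ : IsCutoff fun z : Vec m => ‖z‖₊ - ε.toNNReal := by
    refine ⟨by fun_prop, ε, hε, fun z hz => ?_⟩
    rw [tsub_eq_zero_iff_le, ← norm_toNNReal]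
    exact Real.toNNReal_le_toNNReal hz
  obtain ⟨R, -, hR⟩ := exists_finset_jump hφ hf 1
  rw [← lintegral_indicator_one hm, lintegral_jumpLaw f (measurable_one.indicator hm)
    (by simp [hε.le]), tsum_eq_sum (s := R)]
  · refine ENNReal.sum_lt_top.2 fun s _ => ?_
    refine lt_of_le_of_lt ((Set.indicator_le_self _ _ _).trans (Set.indicator_le_self _ _ _)) ?_
    simp
  · intro s hs
    by_cases h1 : s ∈ Set.Iic (1 : ℝ≥0)
    · rw [Set.indicator_of_mem h1, Set.indicator_of_notMem]
      have := hR s h1 hs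
      rw [tsub_eq_zero_iff_le, ← norm_toNNReal] at this
      exact fun h => absurd ((Real.toNNReal_le_toNNReal_iff hε.le).1 this) (not_le.2 h)
    · exact Set.indicator_of_notMem h1 _

/-- The jump law may have infinite mass near the origin, so it is exhausted by its restrictions to
`|z| > 1/(j+1)`, which are finite. There open sets form a generating π-system, and their indicators
are increasing limits of cutoffs. The exhaustion loses only the origin, which carries no mass. -/
theorem measurable_jumpLaw (hZ : ∀ t, Measurable[𝓕 t] (Z t))
    (hc : ∀ ω, IsCadlag fun t => Z t ω) : Measurable fun ω => jumpLaw fun t => Z t ω := by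
  have hpos : ∀ j : ℕ, (0 : ℝ) < 1 / (j + 1) := fun j => Nat.one_div_pos_of_nat
  have hopen : ∀ j : ℕ, IsOpen {z : Vec m | 1 / ((j : ℝ) + 1) < ‖z‖} := fun j =>
    isOpen_lt continuous_const continuous_norm
  have hfin : ∀ (j : ℕ) ω, IsFiniteMeasure
      ((jumpLaw fun t => Z t ω).restrict {z : Vec m | 1 / ((j : ℝ) + 1) < ‖z‖}) := fun j ω =>
    ⟨by rw [Measure.restrict_apply_univ]; exact jumpLaw_lt_top (hc ω) (hpos j)⟩
  have hU : ∀ (j : ℕ) (U : Set (Vec m)), IsOpen U → Measurable fun ω =>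
      ((jumpLaw fun t => Z t ω).restrict {z : Vec m | 1 / ((j : ℝ) + 1) < ‖z‖}) U := by
    intro j U hU
    simp_rw [Measure.restrict_apply hU.measurableSet]
    have hU' := hU.inter (hopen j)
    obtain ⟨φ, h1, h2, -, h3⟩ := exists_cutoff_iSup hU' (hpos j) fun z hz => hz.2
    simp_rw [← lintegral_indicator_one hU'.measurableSet, ← h3]
    have : ∀ ω, ∫⁻ z, ⨆ n, (φ n z : ℝ≥0∞) ∂(jumpLaw fun t => Z t ω)
        = ⨆ n, weightedJumps (φ n) (fun t => Z t ω) (Set.Iic 1) := fun ω => by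
      rw [lintegral_iSup (fun n => (h1 n).measurable_coe)
        fun n k hnk z => ENNReal.coe_le_coe.2 (h2 hnk z)]
      simp_rw [lintegral_jumpLaw_cutoff _ (h1 _)]
    simp_rw [this]
    exact Measurable.iSup fun n =>
      (measurable_weightedJumps_Iic hZ hc (h1 n) 1).mono (𝓕.le _) le_rfl
  have hj : ∀ j : ℕ, Measurable fun ω =>
      (jumpLaw fun t => Z t ω).restrict {z : Vec m | 1 / ((j : ℝ) + 1) < ‖z‖} := fun j => by
    refine Measurable.measure_of_isPiSystem (S := {U | IsOpen U})
      (BorelSpace.measurable_eq (α := Vec m)) isPiSystem_isOpen (fun U h => hU j U h)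
      (hU j _ isOpen_univ)
  refine Measure.measurable_of_measurable_coe _ fun B hB => ?_
  have hB' : ∀ ω, jumpLaw (fun t => Z t ω) B = ⨆ j : ℕ,
      ((jumpLaw fun t => Z t ω).restrict {z : Vec m | 1 / ((j : ℝ) + 1) < ‖z‖}) B := fun ω => by
    simp_rw [Measure.restrict_apply hB]
    rw [← Monotone.measure_iUnion]
    · refine le_antisymm ?_ (measure_mono (Set.iUnion_subset fun _ => Set.inter_subset_left))
      refine (measure_mono (t := (⋃ j : ℕ, B ∩ {z : Vec m | 1 / ((j : ℝ) + 1) < ‖z‖}) ∪ {0})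
        fun z hz => ?_).trans ((measure_union_le _ _).trans
          (by rw [jumpLaw_singleton_zero, add_zero]))
      rcases eq_or_ne z 0 with rfl | h0
      · exact Or.inr rfl
      · obtain ⟨j, hj⟩ := exists_nat_one_div_lt (norm_pos_iff.2 h0)
        exact Or.inl (Set.mem_iUnion.2 ⟨j, hz, hj⟩)
    · intro j k hjk z hz
      exact ⟨hz.1, (Nat.one_div_le_one_div hjk).trans_lt (show 1 / ((j : ℝ) + 1) < ‖z‖ from hz.2)⟩
  simp_rw [hB']
  exact Measurable.iSup fun j => (Measure.measurable_coe hB).comp (hj j)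

theorem lintegral_levyMeasure (hZ : ∀ t, Measurable[𝓕 t] (Z t))
    (hc : ∀ ω, IsCadlag fun t => Z t ω) {φ : Vec m → ℝ≥0} (hφ : IsCutoff φ) :
    ∫⁻ z, φ z ∂(levyMeasure Z P) = meanJumps P Z φ 1 := by
  change ∫⁻ z, φ z ∂(P.bind fun ω => jumpLaw fun t => Z t ω) = _
  rw [Measure.lintegral_bind (measurable_jumpLaw hZ hc).aemeasurable
    hφ.measurable_coe.aemeasurable, meanJumps]
  refine lintegral_congr fun ω => ?_
  rw [lintegral_jumpLaw_cutoff _ hφ, measure_Iic_eq_Ioc (weightedJumps_singleton_zero hφ)]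

end JumpLaw

/-! ### Independent Lévy processes do not jump together -/

section CommonJumps

variable {m : ℕ} {Ω : Type*} {mΩ : MeasurableSpace Ω} {P : Measure Ω}
  {𝓕 : Filtration ℝ≥0 mΩ} {Z W : ℝ≥0 → Ω → Vec m}

/-- The `n`-th powers of `x = E exp(-φ(Z_{L/n}))` converge to a positive limit, so eventually `x^n >
d > 0`. As `x^n ≤ exp(-n(1 - x))`, this gives `n(1 - x) ≤ -log d`, and `y ≤ 2(1 - exp(-y))` on `[0,
1]` passes to the mean of `φ`. -/
theorem exists_eventually_mul_lintegral_le [IsProbabilityMeasure P] (hZ : IsLevyProcess Z 𝓕 P)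
    (hc : ∀ ω, IsCadlag fun t => Z t ω) {φ : Vec m → ℝ≥0} (hφ : IsCutoff φ)
    (hφ1 : ∀ z, φ z ≤ 1) (L : ℝ≥0) :
    ∃ C : ℝ≥0, ∀ᶠ n : ℕ in atTop, n * ∫⁻ ω, φ (Z (L / n) ω) ∂P ≤ C := by
  have hZm : ∀ t, Measurable (Z t) := fun t => (hZ.adapted t).mono (𝓕.le _) le_rfl
  have hlim := tendsto_laplace hZ hc hφ 1 0 L (F := Set.univ) MeasurableSet.univ
  simp only [measure_univ, one_mul, Measure.restrict_univ, zero_add, NNReal.coe_one] at hlim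
  set ψ := ∫⁻ ω, ENNReal.ofReal (Real.exp (-(weightedJumps φ (fun t => Z t ω)
    (Set.Ioc 0 L)).toReal)) ∂P with hψ
  have hm : Measurable fun ω => weightedJumps φ (fun t => Z t ω) (Set.Ioc 0 L) := by
    simpa using measurable_weightedJumps_Ioc' hZ hc hφ 0 L
  have hψ0 : ψ ≠ 0 := by
    rw [hψ, Ne, lintegral_eq_zero_iff (by fun_prop)]
    intro h
    obtain ⟨ω, hω⟩ := h.exists
    simp only [Pi.zero_apply, ENNReal.ofReal_eq_zero] at hω
    exact absurd (Real.exp_pos _) (not_lt.2 hω)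
  have hle1 : ∀ h, laplace P Z φ 1 h ≤ 1 := fun h => by
    refine (lintegral_mono (g := 1) fun ω => ?_).trans (by simp)
    exact ENNReal.ofReal_le_one.2 (Real.exp_le_one_iff.2 (by simp))
  obtain ⟨d, hd0, hd⟩ := ENNReal.lt_iff_exists_nnreal_btwn.1 (pos_iff_ne_zero.2 hψ0)
  have hd0' : (0 : ℝ) < d := by exact_mod_cast hd0
  refine ⟨(2 * (-Real.log d)).toNNReal, ?_⟩
  filter_upwards [hlim.eventually_const_lt hd] with n hn
  have hφm : Measurable φ := hφ.continuous.measurable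
  set x := laplace P Z φ 1 (L / n) with hx
  have hx1 : x ≤ 1 := hle1 _
  have hxt : x ≠ ∞ := (hx1.trans_lt (by simp)).ne
  have hxr : x.toReal ≤ 1 := by simpa using ENNReal.toReal_mono (by simp) hx1
  have hint : ∫⁻ ω, φ (Z (L / n) ω) ∂P ≤ 2 * (1 - x) := by
    rw [hx, laplace]
    calc ∫⁻ ω, (φ (Z (L / n) ω) : ℝ≥0∞) ∂P
        ≤ ∫⁻ ω, 2 * (1 - ENNReal.ofReal (Real.exp (-((1 : ℝ≥0) * φ (Z (L / n) ω))))) ∂P := by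
          refine lintegral_mono fun ω => ?_
          set y : ℝ := (φ (Z (L / n) ω) : ℝ) with hy
          have hy0 : 0 ≤ y := NNReal.coe_nonneg _
          have hy1 : y ≤ 1 := by exact_mod_cast hφ1 _
          -- Follows from `exp y ≥ 1 + y` and `(1 + y)(1 - y/2) ≥ 1` for `0 ≤ y ≤ 1`.
          have he : Real.exp (-y) ≤ 1 - y / 2 := by
            rw [Real.exp_neg, inv_le_comm₀ (Real.exp_pos _) (by linarith)]
            refine le_trans ?_ (Real.add_one_le_exp y)
            rw [inv_le_iff_one_le_mul₀ (by linarith)]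
            nlinarith
          rw [← ENNReal.ofReal_coe_nnreal, ← hy, ← ENNReal.ofReal_one,
            ← ENNReal.ofReal_sub _ (Real.exp_pos _).le, ← ENNReal.ofReal_ofNat 2,
            ← ENNReal.ofReal_mul (by norm_num)]
          refine ENNReal.ofReal_le_ofReal ?_
          simp only [NNReal.coe_one, one_mul]
          linarith
      _ = _ := by
          have hmeas : Measurable fun ω =>
              ENNReal.ofReal (Real.exp (-((1 : ℝ≥0) * φ (Z (L / n) ω)))) := by
            have := hφm.comp (hZm (L / n))
            simp only [Function.comp_def] at this
            fun_prop
          rw [lintegral_const_mul' _ _ (by simp), lintegral_sub hmeas hxt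
            (Eventually.of_forall fun ω => ENNReal.ofReal_le_one.2
              (Real.exp_le_one_iff.2 (by simp)))]
          simp
  refine (mul_le_mul_right hint _).trans ?_
  have hn' : (d : ℝ) < x.toReal ^ n := by
    have := (ENNReal.toReal_lt_toReal (by simp) (ENNReal.pow_ne_top hxt)).2 hn
    simpa using this
  have hexp : x.toReal ^ n ≤ Real.exp (-(n * (1 - x.toReal))) := by
    have : x.toReal ≤ Real.exp (-(1 - x.toReal)) := by
      linarith [Real.add_one_le_exp (-(1 - x.toReal))]
    calc x.toReal ^ n ≤ Real.exp (-(1 - x.toReal)) ^ n := by gcongr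
      _ = _ := by rw [← Real.exp_nat_mul]; ring_nf
  have hlog : Real.log d < -(n * (1 - x.toReal)) :=
    (Real.log_lt_iff_lt_exp hd0').2 (hn'.trans_le hexp)
  rw [← ENNReal.ofReal_toReal hxt, ← ENNReal.ofReal_one, ← ENNReal.ofReal_sub _
    ENNReal.toReal_nonneg, ← ENNReal.ofReal_ofNat 2, ← ENNReal.ofReal_mul (by norm_num),
    ← ENNReal.ofReal_natCast, ← ENNReal.ofReal_mul (by positivity)]
  refine ENNReal.ofReal_le_ofReal ?_
  linarith

theorem IsCadlag.jump_prod {f g : ℝ≥0 → Vec m} (hf : IsCadlag f) (hg : IsCadlag g) (s : ℝ≥0) :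
    ContinuousWithinAt (fun t => (f t, g t)) (Set.Ici s) s ∧
      Tendsto (fun t => (f t, g t)) (𝓝[<] s)
        (𝓝 (Function.leftLim f s, Function.leftLim g s)) :=
  ⟨(hf s).1.prodMk (hg s).1, (hf.tendsto_leftLim s).prodMk_nhds (hg.tendsto_leftLim s)⟩

/-- The products of weighted jumps are limits of sums of `φ(ΔZ) φ(ΔW)` over `n` cells. By
independence each cell has mean of order `n⁻²`, so the sums have mean of order `n⁻¹`; Fatou
finishes. -/
theorem ae_mul_common_jumps_eq_zero [IsProbabilityMeasure P] (hZ : IsLevyProcess Z 𝓕 P)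
    (hW : IsLevyProcess W 𝓕 P) (hZc : ∀ ω, IsCadlag fun t => Z t ω)
    (hWc : ∀ ω, IsCadlag fun t => W t ω)
    (hind : IndepFun (fun ω t => Z t ω) (fun ω t => W t ω) P)
    {φ : Vec m → ℝ≥0} (hφ : IsCutoff φ) (hφ1 : ∀ z, φ z ≤ 1) (L : ℝ≥0) :
    ∀ᵐ ω ∂P, ∀ s ∈ Set.Ioc 0 L, φ (jump (fun t => Z t ω) s) * φ (jump (fun t => W t ω) s) = 0 := by
  have hZm : ∀ t, Measurable (Z t) := fun t => (hZ.adapted t).mono (𝓕.le _) le_rfl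
  have hWm : ∀ t, Measurable (W t) := fun t => (hW.adapted t).mono (𝓕.le _) le_rfl
  have hφm : Measurable φ := hφ.continuous.measurable
  obtain ⟨C, hC⟩ := exists_eventually_mul_lintegral_le hZ hZc hφ hφ1 L
  obtain ⟨D, hD⟩ := exists_eventually_mul_lintegral_le hW hWc hφ hφ1 L
  set Φ : Vec m × Vec m → ℝ≥0 := fun x => φ x.1 * φ x.2 with hΦ
  have hΦc : Continuous Φ :=
    (hφ.continuous.comp continuous_fst).mul (hφ.continuous.comp continuous_snd)
  obtain ⟨ε, hε, h0⟩ := hφ.eq_zero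
  have hΦ0 : ∀ z, ‖z‖ ≤ ε → Φ z = 0 := fun z hz => by
    rw [hΦ]; simp [h0 z.1 ((norm_fst_le z).trans hz)]
  set S : ℕ → Ω → ℝ≥0∞ := fun n ω => incSum Φ (fun t => (Z t ω, W t ω)) 0 L n with hS
  have hSm : ∀ n, Measurable (S n) := fun n => by
    refine measurable_coe_nnreal_ennreal.comp (Finset.measurable_sum _ fun i _ => ?_)
    exact hΦc.measurable.comp
      (((hZm _).prodMk (hWm _)).sub ((hZm _).prodMk (hWm _)))
  have hlim : ∀ ω, Tendsto (fun n => S n ω) atTop (𝓝 (∑' s, (Set.Ioc 0 L).indicator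
      (fun s => (Φ (jump (fun t => Z t ω) s, jump (fun t => W t ω) s) : ℝ≥0∞)) s)) := fun ω => by
    have := tendsto_incSum (l := fun s => (Function.leftLim (fun t => Z t ω) s,
      Function.leftLim (fun t => W t ω) s)) hΦc hε hΦ0
      (fun s => ((hZc ω).jump_prod (hWc ω) s).1) (fun s => ((hZc ω).jump_prod (hWc ω) s).2) 0 L
    rw [zero_add] at this
    exact this
  have hSint : ∀ n : ℕ, ∫⁻ ω, S n ω ∂P
      = n * ((∫⁻ ω, φ (Z (L / n) ω) ∂P) * ∫⁻ ω, φ (W (L / n) ω) ∂P) := by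
    intro n
    simp only [hS, incSum, ENNReal.ofNNReal_finsetSum]
    rw [lintegral_finsetSum]
    · rw [Finset.sum_congr rfl (g := fun _ => (∫⁻ ω, φ (Z (L / n) ω) ∂P) *
        ∫⁻ ω, φ (W (L / n) ω) ∂P), Finset.sum_const, Finset.card_range, nsmul_eq_mul]
      intro i _
      have hst : ∀ {Y : ℝ≥0 → Ω → Vec m}, IsLevyProcess Y 𝓕 P →
          ∫⁻ ω, (φ (Y (0 + (i + 1 : ℕ) * (L / n)) ω - Y (0 + i * (L / n)) ω) : ℝ≥0∞) ∂P
          = ∫⁻ ω, φ (Y (L / n) ω) ∂P := fun {Y} hY => by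
        have := ((hY.stationary (0 + i * (L / n)) (L / n)).comp
          (measurable_coe_nnreal_ennreal.comp hφm)).lintegral_eq
        simp only [Function.comp_def] at this
        rw [← this]
        push_cast
        simp_rw [add_mul, one_mul, add_assoc]
      rw [← hst hZ, ← hst hW]
      have hg : Measurable fun y : ℝ≥0 → Vec m =>
          (φ (y (0 + (i + 1 : ℕ) * (L / n)) - y (0 + i * (L / n))) : ℝ≥0∞) :=
        measurable_coe_nnreal_ennreal.comp (hφm.comp
          ((measurable_pi_apply _).sub (measurable_pi_apply _)))
      have := lintegral_mul_eq_lintegral_mul_lintegral_of_indepFun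
        (hg.comp (measurable_pi_lambda _ hZm)) (hg.comp (measurable_pi_lambda _ hWm))
        (hind.comp hg hg)
      simp only [Function.comp_def] at this
      rw [← this]
      refine lintegral_congr fun ω => ?_
      simp [hΦ]
    · intro i _
      exact measurable_coe_nnreal_ennreal.comp (hΦc.measurable.comp
        (((hZm _).prodMk (hWm _)).sub ((hZm _).prodMk (hWm _))))
  have hzero : ∫⁻ ω, (∑' s, (Set.Ioc 0 L).indicator
      (fun s => (Φ (jump (fun t => Z t ω) s, jump (fun t => W t ω) s) : ℝ≥0∞)) s) ∂P = 0 := by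
    refine nonpos_iff_eq_zero.1 ?_
    calc _ = ∫⁻ ω, liminf (fun n => S n ω) atTop ∂P :=
          lintegral_congr fun ω => (hlim ω).liminf_eq.symm
      _ ≤ liminf (fun n => ∫⁻ ω, S n ω ∂P) atTop := lintegral_liminf_le hSm
      _ ≤ liminf (fun n : ℕ => (C * D : ℝ≥0∞) * (n : ℝ≥0∞)⁻¹) atTop := by
          refine liminf_le_liminf ?_
          filter_upwards [hC, hD, eventually_gt_atTop 0] with n h1 h2 hn
          have hn0 : (n : ℝ≥0∞) ≠ 0 := by exact_mod_cast hn.ne'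
          rw [hSint]
          calc _ = (n * ∫⁻ ω, φ (Z (L / n) ω) ∂P) * (n * ∫⁻ ω, φ (W (L / n) ω) ∂P) *
                (n : ℝ≥0∞)⁻¹ := by
                rw [show ∀ a b c d : ℝ≥0∞, (a * b) * (a * c) * d = (a * d) * (a * (b * c)) from
                  fun a b c d => by ring, ENNReal.mul_inv_cancel hn0 (by simp), one_mul]
            _ ≤ _ := by gcongr
      _ = 0 := by
          refine Tendsto.liminf_eq ?_
          have := ENNReal.Tendsto.const_mul (a := (C * D : ℝ≥0∞)) ENNReal.tendsto_inv_nat_nhds_zero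
            (Or.inr (by finiteness))
          simpa using this
  have hmeas : Measurable fun ω => ∑' s, (Set.Ioc 0 L).indicator
      (fun s => (Φ (jump (fun t => Z t ω) s, jump (fun t => W t ω) s) : ℝ≥0∞)) s :=
    measurable_of_tendsto_metrizable hSm (tendsto_pi_nhds.2 hlim)
  rw [lintegral_eq_zero_iff hmeas] at hzero
  filter_upwards [hzero] with ω hω s hs
  simp only [Pi.zero_apply, ENNReal.tsum_eq_zero] at hω
  have := hω s
  rw [Set.indicator_of_mem hs] at this
  exact_mod_cast this

/-- Independent Lévy processes almost surely have no common jumps. -/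
theorem ae_no_common_jumps [IsProbabilityMeasure P] (hZ : IsLevyProcess Z 𝓕 P)
    (hW : IsLevyProcess W 𝓕 P) (hZc : ∀ ω, IsCadlag fun t => Z t ω)
    (hWc : ∀ ω, IsCadlag fun t => W t ω)
    (hind : IndepFun (fun ω t => Z t ω) (fun ω t => W t ω) P) :
    ∀ᵐ ω ∂P, ∀ s, jump (fun t => Z t ω) s = 0 ∨ jump (fun t => W t ω) s = 0 := by
  -- These cutoffs are positive exactly on `|z| > 1/(j+1)`, so as `j` varies they detect every
  -- nonzero jump.
  have hφ : ∀ j : ℕ, IsCutoff fun z : Vec m => min 1 (‖z‖₊ - ((j : ℝ≥0) + 1)⁻¹) := fun j => by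
    refine ⟨by fun_prop, ((j : ℝ≥0) + 1)⁻¹, by positivity, fun z hz => ?_⟩
    rw [tsub_eq_zero_iff_le.2 (by exact_mod_cast hz)]
    simp
  have hae : ∀ j L : ℕ, _ := fun j L => ae_mul_common_jumps_eq_zero hZ hW hZc hWc hind (hφ j)
    (fun z => min_le_left _ _) L
  filter_upwards [ae_all_iff.2 fun j => ae_all_iff.2 (hae j)] with ω hω s
  rcases eq_or_ne s 0 with rfl | hs
  · exact Or.inl (jump_zero _)
  by_contra! hne
  obtain ⟨L, hL⟩ := exists_nat_ge s
  obtain ⟨j, hj⟩ := exists_nat_one_div_lt (lt_min (norm_pos_iff.2 hne.1) (norm_pos_iff.2 hne.2))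
  have := hω j L s ⟨pos_iff_ne_zero.2 hs, hL⟩
  have hpos : ∀ z : Vec m, 1 / ((j : ℝ) + 1) < ‖z‖ → min 1 (‖z‖₊ - ((j : ℝ≥0) + 1)⁻¹) ≠ 0 := by
    intro z hz
    have : ((j : ℝ≥0) + 1)⁻¹ < ‖z‖₊ := by
      rw [← NNReal.coe_lt_coe]; push_cast; rwa [one_div] at hz
    exact (lt_min one_pos (tsub_pos_of_lt this)).ne'
  exact mul_ne_zero (hpos _ (hj.trans_le (min_le_left _ _)))
    (hpos _ (hj.trans_le (min_le_right _ _))) this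

end CommonJumps

/-! ### Power inequalities -/

section Elementary

variable {q : ℝ}

/-- If `x ≤ d`, then `x + d ≤ 2d`. Otherwise divide by `x`: convexity on `[1, 2]` gives `(1 + u)^q ≤
1 + 2^q u` for `u = d/x ≤ 1`. -/
theorem add_rpow_le (hq : 1 ≤ q) (x d : ℝ≥0∞) :
    (x + d) ^ q ≤ x ^ q + 2 ^ q * (x ^ (q - 1) * d + d ^ q) := by
  have hq0 : 0 ≤ q := zero_le_one.trans hq
  rcases le_or_gt x d with h | h
  · calc (x + d) ^ q ≤ (2 * d) ^ q := by gcongr; rw [two_mul]; gcongr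
      _ = 2 ^ q * d ^ q := ENNReal.mul_rpow_of_nonneg _ _ hq0
      _ ≤ 2 ^ q * (x ^ (q - 1) * d + d ^ q) := by gcongr; exact le_add_self
      _ ≤ _ := le_add_self
  · rcases eq_or_ne x ∞ with rfl | hx
    · simp [ENNReal.top_rpow_of_pos (zero_lt_one.trans_le hq)]
    · have hd : d ≠ ∞ := (h.trans hx.lt_top).ne
      lift x to ℝ≥0 using hx
      lift d to ℝ≥0 using hd
      have hxd : d < x := by exact_mod_cast h
      have hx0 : 0 < x := zero_le.trans_lt hxd
      refine le_trans ?_ (add_le_add_right (mul_le_mul_right le_self_add _) _)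
      have hu0 : (0 : ℝ) ≤ d / x := by positivity
      have hu1 : (d / x : ℝ) ≤ 1 := div_le_one_of_le₀ (by exact_mod_cast hxd.le) (by positivity)
      have hconv := (convexOn_rpow hq).2 (x := 1) (y := 2) (by simp) (by simp)
        (sub_nonneg.2 hu1) hu0 (by ring)
      simp only [smul_eq_mul, mul_one, Real.one_rpow] at hconv
      have hxr : (0 : ℝ) < x := by exact_mod_cast hx0
      have key : ((x : ℝ) + d) ^ q ≤ (x : ℝ) ^ q + 2 ^ q * ((x : ℝ) ^ (q - 1) * d) := by
        have e1 : (x : ℝ) + d = x * (1 - d / x + d / x * 2) := by field_simp; ring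
        have e2 : (x : ℝ) ^ q = x ^ (q - 1) * x := by
          rw [← Real.rpow_add_one hxr.ne']; congr 1; ring
        rw [e1, Real.mul_rpow hxr.le (by linarith)]
        calc (x : ℝ) ^ q * (1 - d / x + d / x * 2) ^ q
            ≤ x ^ q * (1 - d / x + d / x * 2 ^ q) := by gcongr
          _ ≤ x ^ q * (1 + d / x * 2 ^ q) := by gcongr; linarith
          _ = _ := by
            rw [mul_add, mul_one]
            congr 1
            rw [e2]
            field_simp
      rw [← ENNReal.coe_add, ← ENNReal.coe_rpow_of_nonneg _ hq0,
        ← ENNReal.coe_rpow_of_nonneg _ hq0, ← ENNReal.coe_rpow_of_nonneg _ (sub_nonneg.2 hq)]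
      rw [show (2 : ℝ≥0∞) = ((2 : ℝ≥0) : ℝ≥0∞) from rfl, ← ENNReal.coe_rpow_of_nonneg _ hq0]
      exact_mod_cast key

/-- Discrete Itô formula: insert the times in increasing order and apply `add_rpow_le` at each.
Truncation is harmless since the truncated sum grows by at most `d s`. -/
theorem min_sum_rpow_le (hq : 1 ≤ q) (N : ℝ≥0∞) (d : ℝ≥0 → ℝ≥0∞) (J : Finset ℝ≥0) :
    (min (∑ s ∈ J, d s) N) ^ q
      ≤ 2 ^ q * ∑ s ∈ J, ((min (∑ r ∈ J with r < s, d r) N) ^ (q - 1) * d s + d s ^ q) := by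
  classical
  induction J using Finset.induction_on_max with
  | empty => simp [ENNReal.zero_rpow_of_pos (zero_lt_one.trans_le hq)]
  | insert a J ha ih =>
    have haJ : a ∉ J := fun h => lt_irrefl _ (ha a h)
    have hfa : (insert a J).filter (· < a) = J := by
      rw [Finset.filter_insert, if_neg (lt_irrefl a), Finset.filter_true_of_mem ha]
    have hfs : ∀ s ∈ J, (insert a J).filter (· < s) = J.filter (· < s) := fun s hs => by
      rw [Finset.filter_insert, if_neg (not_lt.2 (ha s hs).le)]
    have hJ : ∑ s ∈ J, ((min (∑ r ∈ insert a J with r < s, d r) N) ^ (q - 1) * d s + d s ^ q)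
        = ∑ s ∈ J, ((min (∑ r ∈ J with r < s, d r) N) ^ (q - 1) * d s + d s ^ q) :=
      Finset.sum_congr rfl fun s hs => by rw [hfs s hs]
    rw [Finset.sum_insert haJ, Finset.sum_insert haJ, hfa, hJ, mul_add, add_comm (d a)]
    have hmin : min (∑ s ∈ J, d s + d a) N ≤ min (∑ s ∈ J, d s) N + d a := by
      rw [min_add]
      exact min_le_min le_rfl le_self_add
    calc _ ≤ (min (∑ s ∈ J, d s) N + d a) ^ q := by gcongr
      _ ≤ _ := add_rpow_le hq _ _
      _ ≤ _ := by rw [add_comm]; gcongr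

/-- Young's inequality by cases: if `y ≤ ε x` the first term suffices, otherwise `x ≤ ε⁻¹ y` and the
second does. -/
theorem rpow_sub_one_mul_le (hq : 1 ≤ q) {ε : ℝ≥0} (hε : ε ≠ 0) (x y : ℝ≥0∞) :
    x ^ (q - 1) * y ≤ ε * x ^ q + ((ε⁻¹ : ℝ≥0) : ℝ≥0∞) ^ (q - 1) * y ^ q := by
  have hq1 : 0 ≤ q - 1 := sub_nonneg.2 hq
  have hpow : ∀ z : ℝ≥0∞, z ^ (q - 1) * z = z ^ q := fun z => by
    conv_rhs => rw [show q = (q - 1) + 1 by ring,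
      ENNReal.rpow_add_of_nonneg _ _ hq1 zero_le_one, ENNReal.rpow_one]
  rcases le_or_gt y (ε * x) with h | h
  · calc x ^ (q - 1) * y ≤ x ^ (q - 1) * (ε * x) := by gcongr
      _ = ε * x ^ q := by rw [← hpow]; ring
      _ ≤ _ := le_self_add
  · have hx : x ≤ ((ε⁻¹ : ℝ≥0) : ℝ≥0∞) * y := by
      calc x = ((ε⁻¹ * ε : ℝ≥0) : ℝ≥0∞) * x := by rw [inv_mul_cancel₀ hε]; simp
        _ = ((ε⁻¹ : ℝ≥0) : ℝ≥0∞) * (ε * x) := by rw [ENNReal.coe_mul, mul_assoc]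
        _ ≤ _ := by gcongr
    calc x ^ (q - 1) * y ≤ (((ε⁻¹ : ℝ≥0) : ℝ≥0∞) * y) ^ (q - 1) * y := by gcongr
      _ = ((ε⁻¹ : ℝ≥0) : ℝ≥0∞) ^ (q - 1) * y ^ q := by
        rw [ENNReal.mul_rpow_of_nonneg _ _ hq1, mul_assoc, hpow]
      _ ≤ _ := le_add_self

theorem IsCutoff.rpow {E : Type*} [NormedAddCommGroup E] {φ : E → ℝ≥0} (hφ : IsCutoff φ)
    (hq : 0 < q) : IsCutoff fun z => φ z ^ q := by
  obtain ⟨ε, hε, h⟩ := hφ.eq_zero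
  exact ⟨(NNReal.continuous_rpow_const hq.le).comp hφ.continuous, ε, hε, fun z hz => by
    rw [h z hz, NNReal.zero_rpow hq.ne']⟩

end Elementary

/-! ### The power inequality along the paths -/

section Paths

variable {m : ℕ} {q : ℝ}

/-- Apply `min_sum_rpow_le` to the merged finite set of jump times. At each time at most one process
jumps, so the power of the total increment is the sum of the powers. -/
theorem min_sum_setLIntegral_rpow_le (hq : 1 ≤ q) {φ : Vec m → ℝ≥0} (hφ : IsCutoff φ)
    {f : ℕ → ℝ≥0 → Vec m} (hf : ∀ k, IsCadlag (f k))
    (hd : ∀ k l, k ≠ l → ∀ s, jump (f k) s = 0 ∨ jump (f l) s = 0)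
    (a : ℕ → ℝ≥0 → ℝ≥0∞) (n : ℕ) (N : ℝ≥0∞) (t : ℝ≥0) :
    (min (∑ k ∈ Finset.range n, ∫⁻ s in Set.Iic t, a k s ∂(weightedJumps φ (f k))) N) ^ q
      ≤ 2 ^ q * ∑ k ∈ Finset.range n,
        (∫⁻ s in Set.Iic t, (min (∑ l ∈ Finset.range n,
            ∫⁻ r in Set.Iio s, a l r ∂(weightedJumps φ (f l))) N) ^ (q - 1) * a k s
            ∂(weightedJumps φ (f k))
          + ∫⁻ s in Set.Iic t, a k s ^ q ∂(weightedJumps (fun z => φ z ^ q) (f k))) := by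
  classical
  have hq0 : 0 < q := zero_lt_one.trans_le hq
  choose R hRt hR using fun k => exists_finset_jump hφ (hf k) t
  set J := (Finset.range n).biUnion R with hJ
  have hJt : ∀ s ∈ J, s ∈ Set.Iic t := fun s hs => by
    obtain ⟨k, -, hk⟩ := Finset.mem_biUnion.1 hs
    exact hRt k s hk
  have hJR : ∀ k ∈ Finset.range n, ∀ s ≤ t, s ∉ J → φ (jump (f k) s) = 0 := fun k hk s hs hsJ =>
    hR k s hs fun h => hsJ (Finset.mem_biUnion.2 ⟨k, hk, h⟩)
  have hJR' : ∀ k ∈ Finset.range n, ∀ s ≤ t, s ∉ J → φ (jump (f k) s) ^ q = 0 :=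
    fun k hk s hs hsJ => by rw [hJR k hk s hs hsJ, NNReal.zero_rpow hq0.ne']
  have hI : ∀ k ∈ Finset.range n, ∀ h : ℝ≥0 → ℝ≥0∞,
      ∫⁻ s in Set.Iic t, h s ∂(weightedJumps φ (f k)) = ∑ s ∈ J, φ (jump (f k) s) * h s :=
    fun k hk h => by
      rw [setLIntegral_weightedJumps_eq_sum (hJR k hk) h measurableSet_Iic subset_rfl,
        Finset.filter_true_of_mem hJt]
  have hI' : ∀ k ∈ Finset.range n, ∀ h : ℝ≥0 → ℝ≥0∞,
      ∫⁻ s in Set.Iic t, h s ∂(weightedJumps (fun z => φ z ^ q) (f k))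
        = ∑ s ∈ J, (φ (jump (f k) s) ^ q : ℝ≥0) * h s :=
    fun k hk h => by
      rw [setLIntegral_weightedJumps_eq_sum (φ := fun z => φ z ^ q) (hJR' k hk) h
        measurableSet_Iic subset_rfl, Finset.filter_true_of_mem hJt]
  set d : ℝ≥0 → ℝ≥0∞ := fun s => ∑ k ∈ Finset.range n, φ (jump (f k) s) * a k s with hdd
  have hleft : ∀ s ∈ J, ∑ l ∈ Finset.range n, ∫⁻ r in Set.Iio s, a l r ∂(weightedJumps φ (f l))
      = ∑ r ∈ J with r < s, d r := fun s hs => by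
    rw [hdd, Finset.sum_comm]
    refine Finset.sum_congr rfl fun l hl => ?_
    rw [setLIntegral_weightedJumps_eq_sum (hJR l hl) _ measurableSet_Iio
      fun r hr => (le_of_lt (Set.mem_Iio.1 hr)).trans (hJt s hs)]
    rfl
  have hdq : ∀ s, d s ^ q = ∑ k ∈ Finset.range n, (φ (jump (f k) s) ^ q : ℝ≥0) * a k s ^ q := by
    intro s
    have hterm : ∀ k, ((φ (jump (f k) s) ^ q : ℝ≥0) : ℝ≥0∞) * a k s ^ q
        = (φ (jump (f k) s) * a k s) ^ q := fun k => by
      rw [ENNReal.mul_rpow_of_nonneg _ _ hq0.le, ENNReal.coe_rpow_of_nonneg _ hq0.le]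
    simp_rw [hterm, hdd]
    by_cases h : ∃ k ∈ Finset.range n, jump (f k) s ≠ 0
    · obtain ⟨k, hk, hks⟩ := h
      have hz : ∀ l ∈ Finset.range n, l ≠ k → (φ (jump (f l) s) * a l s : ℝ≥0∞) = 0 :=
        fun l _ hlk => by
          rw [(hd l k hlk s).resolve_right hks, hφ.map_zero, ENNReal.coe_zero, zero_mul]
      rw [Finset.sum_eq_single_of_mem k hk hz, Finset.sum_eq_single_of_mem k hk
        fun l hl hlk => by rw [hz l hl hlk, ENNReal.zero_rpow_of_pos hq0]]
    · push Not at h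
      have hz : ∀ l ∈ Finset.range n, (φ (jump (f l) s) * a l s : ℝ≥0∞) = 0 := fun l hl => by
        rw [h l hl, hφ.map_zero, ENNReal.coe_zero, zero_mul]
      rw [Finset.sum_eq_zero hz, ENNReal.zero_rpow_of_pos hq0, Finset.sum_eq_zero fun l hl => by
        rw [hz l hl, ENNReal.zero_rpow_of_pos hq0]]
  have hL : ∑ k ∈ Finset.range n, ∫⁻ s in Set.Iic t, a k s ∂(weightedJumps φ (f k))
      = ∑ s ∈ J, d s := by
    rw [hdd, Finset.sum_comm]
    exact Finset.sum_congr rfl fun k hk => hI k hk _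
  have hR₁ : ∀ k ∈ Finset.range n,
      (∫⁻ s in Set.Iic t, (min (∑ l ∈ Finset.range n,
            ∫⁻ r in Set.Iio s, a l r ∂(weightedJumps φ (f l))) N) ^ (q - 1) * a k s
            ∂(weightedJumps φ (f k))
          + ∫⁻ s in Set.Iic t, a k s ^ q ∂(weightedJumps (fun z => φ z ^ q) (f k)))
      = ∑ s ∈ J, ((min (∑ r ∈ J with r < s, d r) N) ^ (q - 1) * (φ (jump (f k) s) * a k s)
          + (φ (jump (f k) s) ^ q : ℝ≥0) * a k s ^ q) := fun k hk => by
    rw [hI k hk, hI' k hk, ← Finset.sum_add_distrib]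
    refine Finset.sum_congr rfl fun s hs => ?_
    rw [hleft s hs]
    ring
  rw [hL, Finset.sum_congr rfl hR₁, Finset.sum_comm (s := Finset.range n)]
  refine (min_sum_rpow_le hq N d J).trans (le_of_eq ?_)
  congr 1
  refine Finset.sum_congr rfl fun s _ => ?_
  rw [hdq, Finset.sum_add_distrib, ← Finset.mul_sum]

end Paths

/-! ### Predictability of the left-limit process -/

section Predictability

variable {m : ℕ} {Ω : Type*} {mΩ : MeasurableSpace Ω} {P : Measure Ω}
  {𝓕 : Filtration ℝ≥0 mΩ}

theorem measurable_setLIntegral_weightedJumps {Z : ℝ≥0 → Ω → Vec m}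
    (hZ : ∀ t, Measurable[𝓕 t] (Z t))
    (hc : ∀ ω, IsCadlag fun t => Z t ω) {φ : Vec m → ℝ≥0} (hφ : IsCutoff φ) (r : ℝ≥0)
    {a : ℝ≥0 × Ω → ℝ≥0∞} (ha : Measurable[𝓕.predictable] a) :
    Measurable[𝓕 r] fun ω =>
      ∫⁻ s in Set.Iic r, a (s, ω) ∂(weightedJumps φ fun t => Z t ω) := by
  -- Replacing `s` by `min s r` changes nothing on `[0, r]` and makes the integrand factor through
  -- `[0, r] × Ω`, where predictable functions are jointly measurable with respect to `𝓕 r`.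
  have h1 : ∀ ω, ∫⁻ s in Set.Iic r, a (s, ω) ∂(weightedJumps φ fun t => Z t ω)
      = ∫⁻ s in Set.Iic r, a (min s r, ω) ∂(weightedJumps φ fun t => Z t ω) := fun ω =>
    setLIntegral_congr_fun measurableSet_Iic fun s hs => by
      rw [min_eq_left (Set.mem_Iic.1 hs)]
  simp_rw [h1]
  refine @measurable_lintegral_of_isFiniteMeasure _ _ (𝓕 r) _ _
    (measurable_weightedJumps_restrict hZ hc hφ r)
    (fun ω => isFiniteMeasure_weightedJumps_restrict hφ (hc ω) r) (fun ω s => a (min s r, ω)) ?_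
  have hincl := measurable_inclusion_predictable (𝓕 := 𝓕) (i := r)
  let : MeasurableSpace Ω := 𝓕 r
  have hmin : Measurable fun x : Ω × ℝ≥0 =>
      ((⟨min x.2 r, Set.mem_Iic.2 (min_le_right _ _)⟩, x.1) : Set.Iic r × Ω) :=
    (Measurable.subtype_mk (measurable_snd.min measurable_const)).prodMk measurable_fst
  exact ha.comp (hincl.comp hmin)

theorem measurable_predictable_Ioi {r : ℝ≥0} {A : Ω → ℝ≥0∞} (hA : Measurable[𝓕 r] A) :
    Measurable[𝓕.predictable] fun x : ℝ≥0 × Ω => (Set.Ioi r).indicator (fun _ => A x.2) x.1 := by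
  let : MeasurableSpace (ℝ≥0 × Ω) := 𝓕.predictable
  refine measurable_of_Ioi fun c => ?_
  have : (fun x : ℝ≥0 × Ω => (Set.Ioi r).indicator (fun _ => A x.2) x.1) ⁻¹' Set.Ioi c
      = Set.Ioi r ×ˢ (A ⁻¹' Set.Ioi c) := by
    ext ⟨s, ω⟩
    by_cases h : r < s <;> simp [h]
  rw [this]
  exact measurableSet_predictable_Ioi_prod (hA measurableSet_Ioi)

/-- The accumulated sum `A r` is nondecreasing in `r`, so its value over `[0, s)` is the supremum of
`A r` over `r < s` in a countable dense set; each `A r` switched on after time `r` is predictable.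
-/
theorem measurable_predictable_sum_Iio {Z : ℕ → ℝ≥0 → Ω → Vec m}
    (hZ : ∀ k t, Measurable[𝓕 t] (Z k t))
    (hc : ∀ k ω, IsCadlag fun t => Z k t ω) {φ : Vec m → ℝ≥0} (hφ : IsCutoff φ)
    {a : ℕ → ℝ≥0 × Ω → ℝ≥0∞} (ha : ∀ k, Measurable[𝓕.predictable] (a k)) (n : ℕ) :
    Measurable[𝓕.predictable] fun x : ℝ≥0 × Ω => ∑ k ∈ Finset.range n,
      ∫⁻ s in Set.Iio x.1, a k (s, x.2) ∂(weightedJumps φ fun t => Z k t x.2) := by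
  obtain ⟨D, hDc, hD⟩ := TopologicalSpace.exists_countable_dense ℝ≥0
  set A : ℝ≥0 → Ω → ℝ≥0∞ := fun r ω => ∑ k ∈ Finset.range n,
    ∫⁻ s in Set.Iic r, a k (s, ω) ∂(weightedJumps φ fun t => Z k t ω) with hA
  have hAm : ∀ r, Measurable[𝓕 r] (A r) := fun r => Finset.measurable_sum _ fun k _ =>
    measurable_setLIntegral_weightedJumps (hZ k) (hc k) hφ r (ha k)
  have heq : (fun x : ℝ≥0 × Ω => ∑ k ∈ Finset.range n,
      ∫⁻ s in Set.Iio x.1, a k (s, x.2) ∂(weightedJumps φ fun t => Z k t x.2))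
      = fun x => ⨆ r ∈ D, (Set.Ioi r).indicator (fun _ => A r x.2) x.1 := by
    ext ⟨s, ω⟩
    refine le_antisymm ?_ (iSup₂_le fun r _ => ?_)
    · rcases eq_or_ne s 0 with rfl | hs
      · simp
      obtain ⟨u, humono, hu, hlim⟩ := hD.exists_seq_strictMono_tendsto_of_lt (pos_iff_ne_zero.2 hs)
      have hun : Set.Iio s = ⋃ i, Set.Iic (u i) := by
        ext r
        simp only [Set.mem_Iio, Set.mem_iUnion, Set.mem_Iic]
        refine ⟨fun hr => ?_, fun ⟨i, hi⟩ => hi.trans_lt (hu i).1.2⟩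
        obtain ⟨i, hi⟩ := (hlim.eventually_const_lt hr).exists
        exact ⟨i, hi.le⟩
      have hmono : Monotone fun i => Set.Iic (u i) := fun i j hij =>
        Set.Iic_subset_Iic.2 (humono.monotone hij)
      have hk : ∀ k, ∫⁻ r in Set.Iio s, a k (r, ω) ∂(weightedJumps φ fun t => Z k t ω)
          = ⨆ i, ∫⁻ r in Set.Iic (u i), a k (r, ω) ∂(weightedJumps φ fun t => Z k t ω) :=
        fun k => by rw [hun, setLIntegral_iUnion_of_directed _ hmono.directed_le]
      simp_rw [hk]
      rw [ENNReal.finsetSum_iSup_of_monotone fun k i j hij => lintegral_mono_set (hmono hij)]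
      refine iSup_le fun i => le_iSup₂_of_le (u i) (hu i).2 ?_
      rw [Set.indicator_of_mem (show s ∈ Set.Ioi (u i) from (hu i).1.2)]
    · by_cases h : r < s
      · rw [Set.indicator_of_mem (show s ∈ Set.Ioi r from h)]
        exact Finset.sum_le_sum fun k _ => lintegral_mono_set (Set.Iic_subset_Iio.2 h)
      · rw [Set.indicator_of_notMem (show s ∉ Set.Ioi r from h)]
        exact zero_le
  rw [heq]
  exact Measurable.biSup D hDc fun r _ => measurable_predictable_Ioi (hAm r)

end Predictability

/-! ### The truncated moment inequality -/

section Core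

variable {m : ℕ} {Ω : Type*} {mΩ : MeasurableSpace Ω} {P : Measure Ω}
  {𝓕 : Filtration ℝ≥0 mΩ} {q : ℝ}

/-- The constant in the moment inequality for jump sums with bounded means. -/
noncomputable def momentConst (q : ℝ) (κ κ' : ℝ≥0) : ℝ≥0 :=
  2 * (2 ^ q * κ * (2 * (2 ^ q * κ + 1)) ^ (q - 1) + 2 ^ q * κ')

/-- Take means in the pathwise bound and compensate each term; the integrand with the sum over `[0,
s)` is predictable. Afterwards that sum is bounded by its value at `t`, which leaves the
`ds`-integral. -/
theorem lintegral_min_sum_rpow_le_compensator [IsProbabilityMeasure P] (hq : 1 ≤ q)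
    {Z : ℕ → ℝ≥0 → Ω → Vec m}
    (hZ : ∀ k, IsLevyProcess (Z k) 𝓕 P) (hc : ∀ k ω, IsCadlag fun t => Z k t ω)
    (hd : ∀ᵐ ω ∂P, ∀ k l, k ≠ l → ∀ s, jump (fun t => Z k t ω) s = 0 ∨ jump (fun t => Z l t ω) s = 0)
    {φ : Vec m → ℝ≥0} (hφ : IsCutoff φ) {κ κ' : ℝ≥0} (hκ : ∀ k, meanJumps P (Z k) φ 1 ≤ κ)
    (hκ' : ∀ k, meanJumps P (Z k) (fun z => φ z ^ q) 1 ≤ κ')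
    {a : ℕ → ℝ≥0 × Ω → ℝ≥0∞} (ha : ∀ k, Measurable[𝓕.predictable] (a k)) (n : ℕ) (N : ℝ≥0∞)
    (t : ℝ≥0) :
    ∫⁻ ω, (min (∑ k ∈ Finset.range n,
        ∫⁻ s in Set.Iic t, a k (s, ω) ∂(weightedJumps φ fun t => Z k t ω)) N) ^ q ∂P
      ≤ 2 ^ q * (κ * ∫⁻ ω, (min (∑ k ∈ Finset.range n,
        ∫⁻ s in Set.Iic t, a k (s, ω) ∂(weightedJumps φ fun t => Z k t ω)) N) ^ (q - 1)
          * ∫⁻ s in Set.Iic t, ∑' k, a k (s, ω) ∂leb ∂P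
        + κ' * ∫⁻ ω, ∫⁻ s in Set.Iic t, ∑' k, a k (s, ω) ^ q ∂leb ∂P) := by
  have hq0 : 0 < q := zero_lt_one.trans_le hq
  have hφq : IsCutoff fun z => φ z ^ q := hφ.rpow hq0
  have hlebf : IsFiniteMeasure (leb.restrict (Set.Iic t)) :=
    ⟨by rw [Measure.restrict_apply_univ, leb_Iic]; simp⟩
  set A : ℝ≥0 × Ω → ℝ≥0∞ := fun x => ∑ l ∈ Finset.range n,
    ∫⁻ r in Set.Iio x.1, a l (r, x.2) ∂(weightedJumps φ fun t => Z l t x.2) with hA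
  have hAm : Measurable[𝓕.predictable] A :=
    measurable_predictable_sum_Iio (fun k => (hZ k).adapted) hc hφ ha n
  set H : ℕ → ℝ≥0 × Ω → ℝ≥0∞ := fun k x => (min (A x) N) ^ (q - 1) * a k x with hH
  have hHm : ∀ k, Measurable[𝓕.predictable] (H k) := fun k =>
    ((hAm.min measurable_const).pow_const _).mul (ha k)
  have haq : ∀ k, Measurable[𝓕.predictable] fun x => a k x ^ q := fun k => (ha k).pow_const _
  have hWm : ∀ k, Measurable fun ω =>
      ∫⁻ s in Set.Iic t, H k (s, ω) ∂(weightedJumps φ fun t => Z k t ω) := fun k =>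
    (measurable_setLIntegral_weightedJumps (hZ k).adapted (hc k) hφ t (hHm k)).mono (𝓕.le _) le_rfl
  have hWm' : ∀ k, Measurable fun ω =>
      ∫⁻ s in Set.Iic t, a k (s, ω) ^ q ∂(weightedJumps (fun z => φ z ^ q) fun t => Z k t ω) :=
    fun k => (measurable_setLIntegral_weightedJumps (hZ k).adapted (hc k) hφq t
      (haq k)).mono (𝓕.le _) le_rfl
  have hlebm : ∀ {h : ℝ≥0 × Ω → ℝ≥0∞}, Measurable[𝓕.predictable] h →
      Measurable fun ω => ∫⁻ s in Set.Iic t, h (s, ω) ∂leb := fun {h} hh =>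
    Measurable.lintegral_prod_right' (f := fun x : Ω × ℝ≥0 => h x.swap)
      ((hh.mono predictable_le le_rfl).comp measurable_swap)
  have hsec : ∀ {h : ℝ≥0 × Ω → ℝ≥0∞}, Measurable[𝓕.predictable] h → ∀ ω,
      Measurable fun s => h (s, ω) := fun {h} hh ω =>
    (hh.mono predictable_le le_rfl).comp measurable_prodMk_right
  have hκt : ∀ k, meanJumps P (Z k) φ 1 ≠ ∞ := fun k => ((hκ k).trans_lt (by simp)).ne
  have hκt' : ∀ k, meanJumps P (Z k) (fun z => φ z ^ q) 1 ≠ ∞ := fun k =>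
    ((hκ' k).trans_lt (by simp)).ne
  calc _ ≤ ∫⁻ ω, 2 ^ q * ∑ k ∈ Finset.range n,
        (∫⁻ s in Set.Iic t, H k (s, ω) ∂(weightedJumps φ fun t => Z k t ω)
          + ∫⁻ s in Set.Iic t, a k (s, ω) ^ q ∂(weightedJumps (fun z => φ z ^ q)
            fun t => Z k t ω)) ∂P := by
        refine lintegral_mono_ae ?_
        filter_upwards [hd] with ω hω
        exact min_sum_setLIntegral_rpow_le hq hφ (fun k => hc k ω) hω (fun k s => a k (s, ω)) n N t
    _ = 2 ^ q * ∑ k ∈ Finset.range n,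
        (meanJumps P (Z k) φ 1 * ∫⁻ ω, ∫⁻ s in Set.Iic t, H k (s, ω) ∂leb ∂P
          + meanJumps P (Z k) (fun z => φ z ^ q) 1 *
            ∫⁻ ω, ∫⁻ s in Set.Iic t, a k (s, ω) ^ q ∂leb ∂P) := by
        have hWa : ∀ k, Measurable fun ω =>
            (∫⁻ s in Set.Iic t, H k (s, ω) ∂(weightedJumps φ fun t => Z k t ω)
              + ∫⁻ s in Set.Iic t, a k (s, ω) ^ q ∂(weightedJumps (fun z => φ z ^ q)
                fun t => Z k t ω)) := fun k => (hWm k).add (hWm' k)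
        rw [lintegral_const_mul _ (Finset.measurable_sum _ fun k _ => hWa k),
          lintegral_finsetSum _ fun k _ => hWa k]
        congr 1
        refine Finset.sum_congr rfl fun k _ => ?_
        rw [lintegral_add_left (hWm k),
          lintegral_weightedJumps_predictable (hZ k) (hc k) hφ (hκt k) t (hHm k),
          lintegral_weightedJumps_predictable (H := fun x => a k x ^ q) (hZ k) (hc k) hφq
            (hκt' k) t (haq k)]
    _ ≤ 2 ^ q * ∑ k ∈ Finset.range n,
        (κ * ∫⁻ ω, ∫⁻ s in Set.Iic t, H k (s, ω) ∂leb ∂P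
          + κ' * ∫⁻ ω, ∫⁻ s in Set.Iic t, a k (s, ω) ^ q ∂leb ∂P) := by
        gcongr with k _
        · exact hκ k
        · exact hκ' k
    _ = 2 ^ q * (κ * ∫⁻ ω, ∫⁻ s in Set.Iic t, ∑ k ∈ Finset.range n, H k (s, ω) ∂leb ∂P
          + κ' * ∫⁻ ω, ∫⁻ s in Set.Iic t, ∑ k ∈ Finset.range n, a k (s, ω) ^ q ∂leb ∂P) := by
        rw [Finset.sum_add_distrib, ← Finset.mul_sum, ← Finset.mul_sum,
          ← lintegral_finsetSum _ fun k _ => hlebm (hHm k),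
          ← lintegral_finsetSum _ fun k _ => hlebm (haq k)]
        congr 3
        · refine lintegral_congr fun ω => ?_
          rw [lintegral_finsetSum _ fun k _ => hsec (hHm k) ω]
        · refine lintegral_congr fun ω => ?_
          rw [lintegral_finsetSum _ fun k _ => hsec (haq k) ω]
    _ ≤ _ := by
        gcongr 2 ^ q * (κ * ?_ + κ' * ?_)
        · refine lintegral_mono fun ω => ?_
          rw [← lintegral_const_mul _ (Measurable.tsum fun k => hsec (ha k) ω)]
          refine setLIntegral_mono' measurableSet_Iic fun s hs => ?_
          rw [hH, ← Finset.mul_sum]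
          gcongr ?_ * ?_
          · refine ENNReal.rpow_le_rpow (min_le_min ?_ le_rfl) (sub_nonneg.2 hq)
            refine Finset.sum_le_sum fun l _ => lintegral_mono_set fun r hr => ?_
            exact (le_of_lt (Set.mem_Iio.1 hr)).trans hs
          · exact ENNReal.sum_le_tsum _
        · refine lintegral_mono fun ω => lintegral_mono fun s => ENNReal.sum_le_tsum _

theorem lintegral_min_sum_rpow_le [IsProbabilityMeasure P] (hq : 1 ≤ q)
    {Z : ℕ → ℝ≥0 → Ω → Vec m}
    (hZ : ∀ k, IsLevyProcess (Z k) 𝓕 P) (hc : ∀ k ω, IsCadlag fun t => Z k t ω)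
    (hd : ∀ᵐ ω ∂P, ∀ k l, k ≠ l → ∀ s, jump (fun t => Z k t ω) s = 0 ∨ jump (fun t => Z l t ω) s = 0)
    {φ : Vec m → ℝ≥0} (hφ : IsCutoff φ) {κ κ' : ℝ≥0} (hκ : ∀ k, meanJumps P (Z k) φ 1 ≤ κ)
    (hκ' : ∀ k, meanJumps P (Z k) (fun z => φ z ^ q) 1 ≤ κ')
    {a : ℕ → ℝ≥0 × Ω → ℝ≥0∞} (ha : ∀ k, Measurable[𝓕.predictable] (a k)) (n : ℕ) (N t : ℝ≥0) :
    ∫⁻ ω, (min (∑ k ∈ Finset.range n,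
        ∫⁻ s in Set.Iic t, a k (s, ω) ∂(weightedJumps φ fun t => Z k t ω)) N) ^ q ∂P
      ≤ momentConst q κ κ' * ∫⁻ ω, ((∫⁻ s in Set.Iic t, ∑' k, a k (s, ω) ∂leb) ^ q
        + ∫⁻ s in Set.Iic t, ∑' k, a k (s, ω) ^ q ∂leb) ∂P := by
  have hq0 : 0 < q := zero_lt_one.trans_le hq
  have hlebf : IsFiniteMeasure (leb.restrict (Set.Iic t)) :=
    ⟨by rw [Measure.restrict_apply_univ, leb_Iic]; simp⟩
  have hmain := lintegral_min_sum_rpow_le_compensator hq hZ hc hd hφ hκ hκ' ha n N t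
  set X : Ω → ℝ≥0∞ := fun ω => min (∑ k ∈ Finset.range n,
    ∫⁻ s in Set.Iic t, a k (s, ω) ∂(weightedJumps φ fun t => Z k t ω)) N with hX
  set G : Ω → ℝ≥0∞ := fun ω => ∫⁻ s in Set.Iic t, ∑' k, a k (s, ω) ∂leb with hG
  set D : Ω → ℝ≥0∞ := fun ω => ∫⁻ s in Set.Iic t, ∑' k, a k (s, ω) ^ q ∂leb with hD
  have hXm : Measurable X := by
    refine Measurable.min (Finset.measurable_sum _ fun k _ => ?_) measurable_const
    exact (measurable_setLIntegral_weightedJumps (hZ k).adapted (hc k) hφ t (ha k)).mono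
      (𝓕.le _) le_rfl
  have hGm : Measurable G := Measurable.lintegral_prod_right'
    (f := fun x : Ω × ℝ≥0 => ∑' k, a k x.swap)
    (Measurable.tsum fun k => ((ha k).mono predictable_le le_rfl).comp measurable_swap)
  -- The truncation at a finite `N` serves this: a finite moment may be subtracted below.
  have hfin : ∫⁻ ω, X ω ^ q ∂P ≠ ∞ := by
    refine ((lintegral_mono (g := fun _ => (N : ℝ≥0∞) ^ q) fun ω =>
      ENNReal.rpow_le_rpow (min_le_right _ _) hq0.le).trans_lt ?_).ne
    simp [ENNReal.rpow_lt_top_of_nonneg hq0.le]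
  -- Chosen so that `2^q κ δ⁻¹ ≤ 1/2`, which lets Young's first term be absorbed; the `+ 1` keeps
  -- `δ` positive when `κ = 0`.
  set δ : ℝ≥0 := 2 * (2 ^ q * κ + 1) with hδ
  have hδ0 : δ ≠ 0 := by positivity
  have hyoung : ∫⁻ ω, X ω ^ (q - 1) * G ω ∂P
      ≤ (δ⁻¹ : ℝ≥0) * ∫⁻ ω, X ω ^ q ∂P + (δ : ℝ≥0∞) ^ (q - 1) * ∫⁻ ω, G ω ^ q ∂P := by
    calc _ ≤ ∫⁻ ω, ((δ⁻¹ : ℝ≥0) * X ω ^ q + (δ : ℝ≥0∞) ^ (q - 1) * G ω ^ q) ∂P := by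
          refine lintegral_mono fun ω => ?_
          have := rpow_sub_one_mul_le hq (inv_ne_zero hδ0) (X ω) (G ω)
          rwa [inv_inv] at this
      _ = _ := by
          rw [lintegral_add_left ((hXm.pow_const _).const_mul _),
            lintegral_const_mul _ (hXm.pow_const _), lintegral_const_mul _ (hGm.pow_const _)]
  rw [lintegral_add_left (hGm.pow_const q)]
  change ∫⁻ ω, X ω ^ q ∂P ≤ _
  set E := ∫⁻ ω, X ω ^ q ∂P
  set EG := ∫⁻ ω, G ω ^ q ∂P
  set ED := ∫⁻ ω, D ω ∂P
  have h2q : (2 : ℝ≥0∞) ^ q = ((2 ^ q : ℝ≥0) : ℝ≥0∞) := by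
    rw [ENNReal.coe_rpow_of_nonneg _ hq0.le, ENNReal.coe_ofNat]
  have hδq : (δ : ℝ≥0∞) ^ (q - 1) = ((δ ^ (q - 1) : ℝ≥0) : ℝ≥0∞) := by
    rw [← ENNReal.coe_rpow_of_nonneg _ (sub_nonneg.2 hq)]
  rw [hδq] at hyoung
  rw [h2q] at hmain
  have hhalf : (2 ^ q : ℝ≥0) * κ * δ⁻¹ ≤ 2⁻¹ := by
    rw [hδ, mul_inv, ← mul_assoc, mul_comm _ (2 : ℝ≥0)⁻¹, mul_assoc]
    refine mul_le_of_le_one_right zero_le ?_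
    rw [← div_eq_mul_inv]
    exact div_le_one_of_le₀ (by simp) zero_le
  have hE : E ≤ 2⁻¹ * E + (((2 ^ q * κ * δ ^ (q - 1) : ℝ≥0) : ℝ≥0∞) * EG
      + ((2 ^ q * κ' : ℝ≥0) : ℝ≥0∞) * ED) := by
    calc E ≤ _ := hmain
      _ ≤ ((2 ^ q : ℝ≥0) : ℝ≥0∞) * (κ * ((δ⁻¹ : ℝ≥0) * E + ((δ ^ (q - 1) : ℝ≥0) : ℝ≥0∞) * EG)
          + κ' * ED) := by gcongr
      _ = ((2 ^ q * κ * δ⁻¹ : ℝ≥0) : ℝ≥0∞) * E + (((2 ^ q * κ * δ ^ (q - 1) : ℝ≥0) : ℝ≥0∞) * EG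
          + ((2 ^ q * κ' : ℝ≥0) : ℝ≥0∞) * ED) := by
          simp only [ENNReal.coe_mul]; ring
      _ ≤ _ := by
          gcongr
          calc ((2 ^ q * κ * δ⁻¹ : ℝ≥0) : ℝ≥0∞) ≤ ((2⁻¹ : ℝ≥0) : ℝ≥0∞) :=
                ENNReal.coe_le_coe.2 hhalf
            _ = 2⁻¹ := by rw [ENNReal.coe_inv two_ne_zero]; rfl
  have hE2 : E ≤ 2 * (((2 ^ q * κ * δ ^ (q - 1) : ℝ≥0) : ℝ≥0∞) * EG
      + ((2 ^ q * κ' : ℝ≥0) : ℝ≥0∞) * ED) := by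
    have h2 : E * 2⁻¹ ≠ ∞ := ENNReal.mul_ne_top hfin (by simp)
    have hsplit : E = E * 2⁻¹ + E * 2⁻¹ := by
      rw [← mul_add, ENNReal.inv_two_add_inv_two, mul_one]
    rw [mul_comm (2⁻¹ : ℝ≥0∞)] at hE
    nth_rw 1 [hsplit] at hE
    have := (ENNReal.add_le_add_iff_left h2).1 hE
    calc E = 2 * (E * 2⁻¹) := by
          rw [mul_comm E, ← mul_assoc, ENNReal.mul_inv_cancel two_ne_zero (by simp), one_mul]
      _ ≤ _ := by gcongr
  refine hE2.trans ?_
  have hc1 : (2 : ℝ≥0∞) * ((2 ^ q * κ * δ ^ (q - 1) : ℝ≥0) : ℝ≥0∞) ≤ momentConst q κ κ' := by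
    rw [momentConst, ← hδ]
    push_cast
    gcongr
    exact le_self_add
  have hc2 : (2 : ℝ≥0∞) * ((2 ^ q * κ' : ℝ≥0) : ℝ≥0∞) ≤ momentConst q κ κ' := by
    rw [momentConst, ← hδ]
    push_cast
    gcongr
    exact le_add_self
  rw [mul_add, mul_add, ← mul_assoc, ← mul_assoc]
  gcongr

end Core

/-! ### Monotone limits -/

section Limits

theorem tsum_iSup_of_monotone {ι : Type*} {c : ℕ → ι → ℝ≥0∞} (hc : Monotone c) :
    ∑' i, ⨆ n, c n i = ⨆ n, ∑' i, c n i := by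
  simp_rw [ENNReal.tsum_eq_iSup_sum]
  rw [iSup_comm]
  exact iSup_congr fun s => ENNReal.finsetSum_iSup_of_monotone fun i n k hnk => hc hnk i

theorem iSup_min_natCast {S : ℕ → ℝ≥0∞} (hS : Monotone S) :
    ⨆ n : ℕ, min (S n) n = ⨆ n, S n := by
  refine le_antisymm (iSup_mono fun n => min_le_left _ _) (iSup_le fun n => ?_)
  refine le_of_forall_lt fun x hx => ?_
  obtain ⟨k, hk⟩ := ENNReal.exists_nat_gt (hx.trans_le le_top).ne
  refine lt_of_lt_of_le (lt_min (hx.trans_le (hS (le_max_left n k))) (hk.trans_le ?_))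
    (le_iSup (fun n : ℕ => min (S n) n) (max n k))
  exact_mod_cast le_max_right n k

/-- A single index drives the number of processes, the cutoff and the truncation level; monotonicity
in each makes the diagonal supremum equal to the iterated one. -/
theorem tsum_rpow_eq_iSup {q : ℝ} (hq : 0 < q) {B : ℕ → ℕ → ℝ≥0∞} (hB : ∀ k, Monotone (B k)) :
    Monotone (fun n : ℕ => (min (∑ k ∈ Finset.range n, B k n) n) ^ q) ∧
    (∑' k, ⨆ n, B k n) ^ q = ⨆ n : ℕ, (min (∑ k ∈ Finset.range n, B k n) n) ^ q := by
  have hmono : Monotone fun n : ℕ => ∑ k ∈ Finset.range n, B k n := fun n j hnj =>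
    (Finset.sum_le_sum fun k _ => hB k hnj).trans
      (Finset.sum_le_sum_of_subset (Finset.range_mono hnj))
  have hmin : Monotone fun n : ℕ => min (∑ k ∈ Finset.range n, B k n) n := fun n j hnj =>
    min_le_min (hmono hnj) (by exact_mod_cast hnj)
  refine ⟨fun n j hnj => ENNReal.rpow_le_rpow (hmin hnj) hq.le, ?_⟩
  have hsum : ∑' k, ⨆ n, B k n = ⨆ n : ℕ, min (∑ k ∈ Finset.range n, B k n) n := by
    rw [iSup_min_natCast hmono, tsum_iSup_of_monotone fun n j hnj k => hB k hnj]
    refine le_antisymm (iSup_le fun n => ?_) (iSup_mono fun n => ENNReal.sum_le_tsum _)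
    rw [ENNReal.tsum_eq_iSup_nat]
    refine iSup_le fun j => le_iSup_of_le (max n j) ?_
    exact (Finset.sum_le_sum fun k _ => hB k (le_max_left n j)).trans
      (Finset.sum_le_sum_of_subset (Finset.range_mono (le_max_right n j)))
  rw [hsum]
  exact (ENNReal.orderIsoRpow q hq).map_iSup _

end Limits

/-! ### Cutoffs increasing to the square of the norm -/

section Cutoff

/-- The cutoff functions `|z|² min(1, ((n + 1)|z| - 1)⁺)`, which increase to `|z|²`. -/
noncomputable def squareCutoff {m : ℕ} (n : ℕ) (z : Vec m) : ℝ≥0 :=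
  ‖z‖₊ ^ 2 * min 1 ((n + 1) * ‖z‖₊ - 1)

variable {m : ℕ}

theorem isCutoff_squareCutoff (n : ℕ) : IsCutoff (squareCutoff n : Vec m → ℝ≥0) := by
  refine ⟨by unfold squareCutoff; fun_prop, 1 / ((n : ℝ) + 1), Nat.one_div_pos_of_nat,
    fun z hz => ?_⟩
  have : ((n : ℝ≥0) + 1) * ‖z‖₊ ≤ 1 := by
    rw [← NNReal.coe_le_coe]
    push_cast
    rwa [le_div_iff₀ (by positivity), mul_comm] at hz
  simp [squareCutoff, tsub_eq_zero_of_le this]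

theorem squareCutoff_mono (z : Vec m) : Monotone fun n => squareCutoff n z := fun n k h => by
  simp only [squareCutoff]
  gcongr

theorem squareCutoff_le (n : ℕ) (z : Vec m) : squareCutoff n z ≤ ‖z‖₊ ^ 2 :=
  mul_le_of_le_one_right zero_le (min_le_left _ _)

theorem iSup_squareCutoff (z : Vec m) : ⨆ n, (squareCutoff n z : ℝ≥0∞) = ‖z‖ₑ ^ 2 := by
  refine le_antisymm (iSup_le fun n => by
    rw [enorm_eq_nnnorm]; exact_mod_cast squareCutoff_le n z) ?_
  rcases eq_or_ne z 0 with rfl | hz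
  · simp
  have hz' : 0 < ‖z‖₊ := nnnorm_pos.2 hz
  obtain ⟨n, hn⟩ := exists_nat_gt (2 * ‖z‖₊⁻¹)
  refine le_iSup_of_le n ?_
  have h1 : 1 ≤ ((n : ℝ≥0) + 1) * ‖z‖₊ - 1 := by
    refine le_tsub_of_add_le_right ?_
    calc (1 : ℝ≥0) + 1 = 2 * ‖z‖₊⁻¹ * ‖z‖₊ := by
          rw [mul_assoc, inv_mul_cancel₀ hz'.ne']; norm_num
      _ ≤ n * ‖z‖₊ := by gcongr
      _ ≤ _ := by gcongr; simp
  rw [squareCutoff, min_eq_left h1, mul_one, enorm_eq_nnnorm]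
  exact_mod_cast le_rfl

theorem lintegral_enorm_rpow_le {ν : Measure (Vec m)} {r : ℝ} (hr : 0 < r) {K : ℝ≥0}
    (h : levyMoment ν r ≤ K) : ∫⁻ z, ‖z‖ₑ ^ r ∂ν ≤ (K ^ r : ℝ≥0) := by
  rw [levyMoment, one_div, ENNReal.rpow_inv_le_iff hr] at h
  rwa [ENNReal.coe_rpow_of_nonneg _ hr.le]

end Cutoff

/-! ### Almost sure modifications, Lebesgue measure and coordinates -/

section Reduction

variable {m : ℕ} {Ω : Type*} {mΩ : MeasurableSpace Ω} {P : Measure Ω}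
  {𝓕 : Filtration ℝ≥0 mΩ}

theorem IsLevyProcess.congr {Z W : ℝ≥0 → Ω → Vec m} (hZ : IsLevyProcess Z 𝓕 P)
    (hW : ∀ t, Measurable[𝓕 t] (W t)) (h : ∀ᵐ ω ∂P, ∀ t, Z t ω = W t ω) :
    IsLevyProcess W 𝓕 P where
  adapted := hW
  zero := by
    filter_upwards [hZ.zero, h] with ω h1 h2
    rw [← h2, h1]
  indep_increments s t hst := by
    rw [Indep_iff]
    rintro _ B ⟨A, hA, rfl⟩ hB
    have h1 := (Indep_iff _ _ P).1 (hZ.indep_increments s t hst) _ B ⟨A, hA, rfl⟩ hB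
    have h2 : ((fun ω => W t ω - W s ω) ⁻¹' A : Set Ω) =ᵐ[P] (fun ω => Z t ω - Z s ω) ⁻¹' A := by
      filter_upwards [h] with ω hω
      simp only [eq_iff_iff]
      change W t ω - W s ω ∈ A ↔ Z t ω - Z s ω ∈ A
      rw [hω, hω]
    rw [measure_congr h2, ← h1]
    exact measure_congr (h2.inter (ae_eq_refl B))
  stationary s u := by
    have hm := hZ.stationary s u
    have e1 : (fun ω => Z (s + u) ω - Z s ω) =ᵐ[P] fun ω => W (s + u) ω - W s ω := by
      filter_upwards [h] with ω hω
      rw [hω, hω]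
    have e2 : Z u =ᵐ[P] W u := by
      filter_upwards [h] with ω hω using hω u
    exact ⟨hm.aemeasurable_fst.congr e1, hm.aemeasurable_snd.congr e2, by
      rw [← Measure.map_congr e1, ← Measure.map_congr e2, hm.map_eq]⟩
  cadlag := by
    filter_upwards [hZ.cadlag, h] with ω h1 h2
    simp_rw [← h2]
    exact h1

theorem levyMeasure_congr {Z W : ℝ≥0 → Ω → Vec m} (h : ∀ᵐ ω ∂P, ∀ t, Z t ω = W t ω) :
    levyMeasure Z P = levyMeasure W P := by
  rw [levyMeasure, levyMeasure, Measure.bind, Measure.bind]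
  congr 1
  refine Measure.map_congr ?_
  filter_upwards [h] with ω hω
  simp_rw [hω]

theorem setLIntegral_leb {F : ℝ≥0 → ℝ≥0∞} (hF : Measurable F) (t : ℝ≥0) :
    ∫⁻ s in Set.Iic t, F s ∂leb = ∫⁻ s in Set.Icc (0 : ℝ) t, F s.toNNReal := by
  rw [leb, setLIntegral_map measurableSet_Iic hF measurable_real_toNNReal,
    Measure.restrict_restrict (measurable_real_toNNReal measurableSet_Iic)]
  congr 2
  ext x
  simp only [Set.mem_inter_iff, Set.mem_preimage, Set.mem_Iic, Set.mem_Ici, Set.mem_Icc,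
    Real.toNNReal_le_iff_le_coe]
  exact and_comm

theorem measurable_toLp_lp_apply {X : Type*} {mX : MeasurableSpace X}
    {h : Fin m → X → lp (fun _ : ℕ => ℝ) 2} (hh : ∀ j, StronglyMeasurable (h j)) (k : ℕ) :
    Measurable fun x => (WithLp.toLp 2 fun j => h j x k : Vec m) :=
  (WithLp.measurable_toLp 2 _).comp (measurable_pi_lambda _ fun j =>
    ((lp.evalCLM ℝ (fun _ : ℕ => ℝ) 2 k).continuous.comp_stronglyMeasurable (hh j)).measurable)

theorem measurable_coordVec {g : Fin m → ℝ≥0 → Ω → lp (fun _ : ℕ => ℝ) 2}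
    (hg : ∀ j, IsStronglyPredictable 𝓕 (g j)) (k : ℕ) :
    Measurable[𝓕.predictable] fun x : ℝ≥0 × Ω => coordVec g k x.1 x.2 :=
  measurable_toLp_lp_apply hg k

end Reduction

/-! ### Removing the cutoffs -/

section Moments

variable {m : ℕ} {Ω : Type*} {mΩ : MeasurableSpace Ω} {P : Measure Ω}
  {𝓕 : Filtration ℝ≥0 mΩ} {p : ℝ}

/-- The moment inequality for processes all of whose paths are càdlàg. -/
theorem lintegral_jumps_rpow_le [IsProbabilityMeasure P] (hp : 2 ≤ p) {K : ℝ≥0}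
    {Z : ℕ → ℝ≥0 → Ω → Vec m}
    (hZ : ∀ k, IsLevyProcess (Z k) 𝓕 P) (hc : ∀ k ω, IsCadlag fun t => Z k t ω)
    (hind : iIndepFun (fun (k : ℕ) (ω : Ω) (t : ℝ≥0) => Z k t ω) P) (hK : cHat Z P p ≤ K)
    {g : Fin m → ℝ≥0 → Ω → lp (fun _ : ℕ => ℝ) 2}
    (hg : ∀ j, IsStronglyPredictable 𝓕 (g j)) (t : ℝ≥0) :
    ∫⁻ ω, (∑' k, ∫⁻ x in Set.Icc 0 t ×ˢ Set.univ,
          ‖coordVec g k x.1 ω‖ₑ ^ 2 * ‖x.2‖ₑ ^ 2 ∂(jumpMeasure fun s => Z k s ω)) ^ (p / 2) ∂P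
      ≤ momentConst (p / 2) (K ^ 2) (K ^ p) *
        ∫⁻ ω, ((∫⁻ s in Set.Icc (0 : ℝ) t,
              ∑' k, ‖coordVec g k s.toNNReal ω‖ₑ ^ 2) ^ (p / 2)
            + ∫⁻ s in Set.Icc (0 : ℝ) t, ∑' k, ‖coordVec g k s.toNNReal ω‖ₑ ^ p) ∂P := by
  have hq : 1 ≤ p / 2 := by linarith
  have hq0 : 0 < p / 2 := by linarith
  have hp0 : 0 < p := by linarith
  set a : ℕ → ℝ≥0 × Ω → ℝ≥0∞ := fun k x => ‖coordVec g k x.1 x.2‖ₑ ^ 2 with ha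
  have ham : ∀ k, Measurable[𝓕.predictable] (a k) := fun k =>
    (measurable_enorm.comp (measurable_coordVec hg k)).pow_const 2
  have hpow : ∀ x : ℝ≥0∞, (x ^ 2) ^ (p / 2) = x ^ p := fun x => by
    rw [← ENNReal.rpow_ofNat, ← ENNReal.rpow_mul]
    congr 1
    ring
  have hsec : ∀ ω k, Measurable fun s => a k (s, ω) := fun ω k =>
    ((ham k).mono predictable_le le_rfl).comp measurable_prodMk_right
  have hrhs : ∀ ω, ((∫⁻ s in Set.Icc (0 : ℝ) t,
      ∑' k, ‖coordVec g k s.toNNReal ω‖ₑ ^ 2) ^ (p / 2)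
        + ∫⁻ s in Set.Icc (0 : ℝ) t, ∑' k, ‖coordVec g k s.toNNReal ω‖ₑ ^ p)
      = ((∫⁻ s in Set.Iic t, ∑' k, a k (s, ω) ∂leb) ^ (p / 2)
        + ∫⁻ s in Set.Iic t, ∑' k, a k (s, ω) ^ (p / 2) ∂leb) := fun ω => by
    rw [setLIntegral_leb (Measurable.tsum fun k => hsec ω k),
      setLIntegral_leb (Measurable.tsum fun k => (hsec ω k).pow_const _)]
    simp only [ha, hpow]
  simp_rw [hrhs]
  have hd : ∀ᵐ ω ∂P, ∀ k l, k ≠ l → ∀ s,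
      jump (fun t => Z k t ω) s = 0 ∨ jump (fun t => Z l t ω) s = 0 := by
    rw [ae_all_iff]
    intro k
    rw [ae_all_iff]
    intro l
    by_cases hkl : k = l
    · exact Eventually.of_forall fun ω h => absurd hkl h
    · filter_upwards [ae_no_common_jumps (hZ k) (hZ l) (hc k) (hc l) (hind.indepFun hkl)] with ω hω
      exact fun _ => hω
  have hK2 : ∀ k, levyMoment (levyMeasure (Z k) P) 2 ≤ K := fun k =>
    (le_max_left _ _).trans ((le_iSup (fun k => max (levyMoment (levyMeasure (Z k) P) 2)
      (levyMoment (levyMeasure (Z k) P) p)) k).trans hK)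
  have hKp : ∀ k, levyMoment (levyMeasure (Z k) P) p ≤ K := fun k =>
    (le_max_right _ _).trans ((le_iSup (fun k => max (levyMoment (levyMeasure (Z k) P) 2)
      (levyMoment (levyMeasure (Z k) P) p)) k).trans hK)
  -- Both means are bounded uniformly in the cutoff, which is what lets the constant survive the
  -- limit.
  have hκ : ∀ n k, meanJumps P (Z k) (squareCutoff n) 1 ≤ (K ^ 2 : ℝ≥0) := fun n k => by
    rw [← lintegral_levyMeasure (hZ k).adapted (hc k) (isCutoff_squareCutoff n)]
    refine (lintegral_mono fun z => ?_).trans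
      ((lintegral_enorm_rpow_le two_pos (hK2 k)).trans_eq (by simp))
    rw [ENNReal.rpow_ofNat, ← iSup_squareCutoff]
    exact le_iSup (fun n => (squareCutoff n z : ℝ≥0∞)) n
  have hκ' : ∀ n k, meanJumps P (Z k) (fun z => squareCutoff n z ^ (p / 2)) 1 ≤ (K ^ p : ℝ≥0) :=
    fun n k => by
    rw [← lintegral_levyMeasure (hZ k).adapted (hc k) ((isCutoff_squareCutoff n).rpow hq0)]
    refine (lintegral_mono fun z => ?_).trans (lintegral_enorm_rpow_le hp0 (hKp k))
    rw [← hpow, ENNReal.coe_rpow_of_nonneg _ hq0.le, ← iSup_squareCutoff]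
    exact ENNReal.rpow_le_rpow (le_iSup (fun n => (squareCutoff n z : ℝ≥0∞)) n) hq0.le
  set B : Ω → ℕ → ℕ → ℝ≥0∞ := fun ω k n =>
    ∫⁻ s in Set.Iic t, a k (s, ω) ∂(weightedJumps (squareCutoff n) fun t => Z k t ω) with hB
  have hBmono : ∀ ω k, Monotone (B ω k) := fun ω k n j hnj => by
    simp only [hB]
    rw [setLIntegral_weightedJumps _ _ _ measurableSet_Iic,
      setLIntegral_weightedJumps _ _ _ measurableSet_Iic]
    refine ENNReal.tsum_le_tsum fun s => Set.indicator_le_indicator ?_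
    gcongr
    exact squareCutoff_mono _ hnj
  have hBsup : ∀ ω k, ∫⁻ x in Set.Icc 0 t ×ˢ Set.univ,
      ‖coordVec g k x.1 ω‖ₑ ^ 2 * ‖x.2‖ₑ ^ 2 ∂(jumpMeasure fun s => Z k s ω) = ⨆ n, B ω k n := by
    intro ω k
    rw [setLIntegral_jumpMeasure _ measurableSet_Icc
      (F := fun x => ‖coordVec g k x.1 ω‖ₑ ^ 2 * ‖x.2‖ₑ ^ 2) (by simp)]
    simp only [hB]
    simp_rw [setLIntegral_weightedJumps _ _ _ measurableSet_Iic]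
    have hmono : Monotone fun (n : ℕ) (s : ℝ≥0) => (Set.Iic t).indicator (fun s =>
        (squareCutoff n (jump (fun s => Z k s ω) s) : ℝ≥0∞) * a k (s, ω)) s :=
      fun n j hnj s => Set.indicator_le_indicator
        (mul_le_mul_left (ENNReal.coe_le_coe.2 (squareCutoff_mono _ hnj)) _)
    rw [← tsum_iSup_of_monotone hmono]
    refine tsum_congr fun s => ?_
    rw [show Set.Icc 0 t = Set.Iic t from Set.Icc_bot]
    by_cases hs : s ∈ Set.Iic t
    · simp_rw [Set.indicator_of_mem hs]
      rw [← ENNReal.iSup_mul, iSup_squareCutoff, mul_comm]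
    · simp_rw [Set.indicator_of_notMem hs]
      simp
  have hlim := fun ω => tsum_rpow_eq_iSup hq0 (hBmono ω)
  simp_rw [hBsup, fun ω => (hlim ω).2]
  rw [lintegral_iSup (fun n => ?_) fun n j hnj ω => (hlim ω).1 hnj]
  · refine iSup_le fun n => ?_
    have := lintegral_min_sum_rpow_le hq hZ hc hd (isCutoff_squareCutoff n) (hκ n) (hκ' n) ham n n t
    exact_mod_cast this
  · refine (Measurable.min (Finset.measurable_sum _ fun k _ => ?_) measurable_const).pow_const _
    exact (measurable_setLIntegral_weightedJumps (hZ k).adapted (hc k)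
      (isCutoff_squareCutoff n) t (ham k)).mono (𝓕.le _) le_rfl

end Moments

end LevyKunita

/-! ### Reduction to processes with all paths càdlàg -/

theorem mainTheorem10 (p : ℝ) (hp : 2 ≤ p) (K : ℝ≥0) :
    ∃ c : ℝ≥0, ∀ (m : ℕ) (Ω : Type*) (mΩ : MeasurableSpace Ω) (P : Measure Ω)
      (_ : IsProbabilityMeasure P) (_ : P.IsComplete)
      (𝓕 : Filtration ℝ≥0 mΩ)
      (_ : ∀ (t : ℝ≥0) (A : Set Ω), P A = 0 → MeasurableSet[𝓕 t] A)
      (Z : ℕ → ℝ≥0 → Ω → Vec m)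
      (_ : ∀ k, IsLevyProcess (Z k) 𝓕 P)
      (_ : iIndepFun (fun (k : ℕ) (ω : Ω) (t : ℝ≥0) => Z k t ω) P)
      (_ : cHat Z P p ≤ K)
      (g : Fin m → ℝ≥0 → Ω → lp (fun _ : ℕ => ℝ) 2)
      (_ : ∀ j, IsStronglyPredictable 𝓕 (g j))
      (_ : ∀ k, ∃ C : ℝ, ∀ s ω, ‖coordVec g k s ω‖ ≤ C)
      (t : ℝ≥0),
      ∫⁻ ω, (∑' k, ∫⁻ x in Set.Icc 0 t ×ˢ Set.univ,
          ‖coordVec g k x.1 ω‖ₑ ^ 2 * ‖x.2‖ₑ ^ 2 ∂(jumpMeasure fun s => Z k s ω)) ^ (p / 2) ∂P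
        ≤ c * ∫⁻ ω, ((∫⁻ s in Set.Icc (0 : ℝ) t,
              ∑' k, ‖coordVec g k s.toNNReal ω‖ₑ ^ 2) ^ (p / 2)
            + ∫⁻ s in Set.Icc (0 : ℝ) t, ∑' k, ‖coordVec g k s.toNNReal ω‖ₑ ^ p) ∂P := by
  refine ⟨momentConst (p / 2) (K ^ 2) (K ^ p), ?_⟩
  intro m Ω mΩ P _ _ 𝓕 hnull Z hZ hind hK g hg _ t
  -- The exceptional set is null, hence lies in every `𝓕 t`. Setting the processes to zero there
  -- keeps them adapted and makes every path càdlàg, without affecting either side.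
  set S : Set Ω := {ω | ∀ k, IsCadlag fun t => Z k t ω} with hS
  have hSae : ∀ᵐ ω ∂P, ω ∈ S := ae_all_iff.2 fun k => (hZ k).cadlag
  have hSm : ∀ t, MeasurableSet[𝓕 t] S := fun t =>
    MeasurableSet.of_compl (hnull t _ (mem_ae_iff.1 hSae))
  set W : ℕ → ℝ≥0 → Ω → Vec m := fun k t => S.indicator (Z k t) with hW
  have heq : ∀ᵐ ω ∂P, ∀ k t, Z k t ω = W k t ω := by
    filter_upwards [hSae] with ω hω k t
    exact (Set.indicator_of_mem hω _).symm
  have heqk : ∀ k, ∀ᵐ ω ∂P, ∀ t, Z k t ω = W k t ω := fun k => by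
    filter_upwards [heq] with ω hω using hω k
  have hWZ : ∀ k, IsLevyProcess (W k) 𝓕 P := fun k =>
    (hZ k).congr (fun t => ((hZ k).adapted t).indicator (hSm t)) (heqk k)
  have hWc : ∀ k ω, IsCadlag fun t => W k t ω := fun k ω => by
    by_cases hω : ω ∈ S
    · have : (fun t => W k t ω) = fun t => Z k t ω := funext fun t => Set.indicator_of_mem hω _
      rw [this]
      exact hω k
    · have : (fun t => W k t ω) = fun _ => 0 := funext fun t => Set.indicator_of_notMem hω _
      rw [this]
      exact fun s => ⟨continuousWithinAt_const, 0, tendsto_const_nhds⟩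
  have hWind : iIndepFun (fun (k : ℕ) (ω : Ω) (t : ℝ≥0) => W k t ω) P :=
    hind.congr fun k => by
      filter_upwards [heqk k] with ω hω
      exact funext hω
  have hWK : cHat W P p ≤ K := by
    have : cHat W P p = cHat Z P p := by
      simp only [cHat]
      exact iSup_congr fun k => by rw [levyMeasure_congr (heqk k)]
    rwa [this]
  refine le_trans (le_of_eq (lintegral_congr_ae ?_)) (lintegral_jumps_rpow_le hp hWZ hWc hWind hWK hg t)
  filter_upwards [heq] with ω hω
  simp_rw [hω]
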